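/- Let $n\ge 0$ and let $V$ be a $(2n+1)$-dimensional complex vector space with a symmetric bilinear form $\beta$ and a basis $e_{-n},\dots,e_n$ such that $\beta(e_i,e_j)=1$ if $i=-j$ and $\beta(e_i,e_j)=0$ otherwise; let $x_{-n},\dots,x_n$ be the dual coordinates. Let $B_n$ be the set of $n$-dimensional subspaces $H\subset V$ with $\beta|_H\equiv 0$. Let $\mathbb{SY}_n$ be the set of sequences $n\ge\lambda_1>\dots>\lambda_n\ge -n$ with $\{|\lambda_1|,\dots,|\lambda_n|\}=\{1,\dots,n\}$. For $\lambda,\mu\in\mathbb{SY}_n$ and a subspace $K\subset V$ put $$X_\mu=\{H\in B_n:\dim H\cap\langle e_{\mu_j},\dots,e_n\rangle\ge j,\ 1\le j\le n\},$$ $$X'_{\lambda^c}=\{H\in B_n:\dim H\cap\langle e_{-n},\dots,e_{\lambda_j}\rangle\ge n+1-j,\ 1\le j\le n\},$$ $$X_K=\{H\in B_n: H\cap K\ne 0\}.$$ The diagram of $\lambda$ is the left-justified array of boxes with $\lambda_j$ boxes in row $j$ whenever $\lambda_j>0$; $\lambda/\mu$ denotes the set-theoretic difference of the diagrams of $\lambda$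 and $\mu$, and its components are the classes of boxes under the equivalence relation generated by sharing a vertex or an edge. We call $\lambda/\mu$ a skew row if $\lambda_1\ge\mu_1\ge\lambda_2\ge\mu_2\ge\dots\ge\lambda_n\ge\mu_n$. For a component $d$ of $\lambda/\mu$, let $\mathrm{col}(d)$ consist of the columns of $d$ and of the column just to the left of $d$ (which is $0$ if $d$ has a box in the first column), let $V_d=\langle e_k,e_{-k}: k\in\mathrm{col}(d)\rangle$, and let $\beta_d$ be the quadratic form on $V$ obtained by composing the coordinate projection $V\to V_d$ with the restriction of $v\mapsto\beta(v,v)$ to $V_d$. Let $Z_{\lambda/\mu}\subset V$ be the common zero locus of all the forms $\beta_d$, of the linear forms $x_{-\lambda_j}$ for all $j$ with $\lambda_j=\mu_j$, and, if no component of $\lambda/\mu$ has a box in the first column, of the linear form $x_0$. Theorem. If $\lambda/\mu$ is a skew row, then for a general line $\langle v\rangle\subset Z_{\lambda/\mu}$ (that is, for all $\langle v\rangle$ in some Zariski open and Zariski dense subset of the set of lines through $0$ contained in $Z_{\lambda/\mu}$, viewed as a subset of $\mathbb P(V)$), the intersection $X_\mu\cap X'_{\lambda^c}\cap X_{\langle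 v\rangle}$ consists of exactly one element. -/

import Mathlib

namespace IsotropicPieri

open Module

/-- The index set `{-n, …, -1, 0, 1, …, n}` of the coordinates of a `(2n+1)`-dimensional space. -/
abbrev Idx (n : ℕ) : Type := Set.Icc (-(n : ℤ)) (n : ℤ)

/-- The index `-i` (written `i` with a bar in the literature). -/
def Idx.bar {n : ℕ} (i : Idx n) : Idx n :=
  ⟨-(i : ℤ), by have h1 := i.2.1; have h2 := i.2.2; constructor <;> omega⟩

/-- The index `0`. -/
def Idx.zero (n : ℕ) : Idx n := ⟨0, by constructor <;> omega⟩

/-- The set `SY_n` of sequences `n ≥ λ₁ > λ₂ > ⋯ > λₙ ≥ -n` whose set of absolute values is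
`{1, …, n}`. The entry `λ_{j+1}` is `λ.seq j` for `j : Fin n`. -/
structure SY (n : ℕ) where
  seq : Fin n → Idx n
  strictAnti : StrictAnti seq
  range_natAbs : Set.range (fun j => (seq j : ℤ).natAbs) = Set.Icc 1 n

variable {n : ℕ}

/-- `λ/μ` is a skew row: `λ₁ ≥ μ₁ ≥ λ₂ ≥ μ₂ ≥ ⋯ ≥ λₙ ≥ μₙ`. -/
def IsSkewRow (lam mu : SY n) : Prop :=
  (∀ j, mu.seq j ≤ lam.seq j) ∧
    ∀ j k : Fin n, (k : ℕ) = (j : ℕ) + 1 → lam.seq k ≤ mu.seq j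

/-! ### Diagrams and components -/

/-- The diagram of `λ`: the boxes `(row, column)`, with `λ_j` boxes in row `j` when `λ_j > 0`. -/
def diagram (lam : SY n) : Set (Fin n × ℤ) :=
  {b | 1 ≤ b.2 ∧ b.2 ≤ (lam.seq b.1 : ℤ)}

/-- The skew diagram `λ/μ`, a set-theoretic difference. -/
def skewDiagram (lam mu : SY n) : Set (Fin n × ℤ) := diagram lam \ diagram mu

/-- Two different boxes of `λ/μ` are joined if they share a vertex or an edge. -/
def boxGraph (lam mu : SY n) : SimpleGraph (skewDiagram lam mu) where
  Adj a b := a ≠ b ∧ |((a.1.1 : ℕ) : ℤ) - ((b.1.1 : ℕ) : ℤ)| ≤ 1 ∧ |a.1.2 - b.1.2| ≤ 1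
  symm := ⟨fun a b h => ⟨h.1.symm, by rw [abs_sub_comm]; exact h.2.1,
    by rw [abs_sub_comm]; exact h.2.2⟩⟩
  loopless := ⟨fun _ h => h.1 rfl⟩

/-- The components of `λ/μ`. -/
abbrev Component (lam mu : SY n) : Type := (boxGraph lam mu).ConnectedComponent

/-- The columns that contain a box of the component `d`. -/
def Component.columns {lam mu : SY n} (d : Component lam mu) : Set ℤ :=
  {c | ∃ b : skewDiagram lam mu, (boxGraph lam mu).connectedComponentMk b = d ∧ b.1.2 = c}

/-- `col(d)`: the columns of `d` together with the column just to the left of `d`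
(which is `0` if `d` meets the first column). -/
def Component.col {lam mu : SY n} (d : Component lam mu) : Set ℤ :=
  {c | c ∈ d.columns ∨ IsLeast d.columns (c + 1)}

/-! ### The orthogonal Grassmannian and its Schubert varieties -/

variable {V : Type*} [AddCommGroup V] [Module ℂ V]

/-- `e_{-n}, …, e_n` is a basis of `V` with `β(e_i, e_j) = 1` if `i = -j` and `0` otherwise. -/
def IsStandardBasis (β : LinearMap.BilinForm ℂ V) (e : Basis (Idx n) ℂ V) : Prop :=
  ∀ i j : Idx n, β (e i) (e j) = if (i : ℤ) = -(j : ℤ) then 1 else 0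

/-- The Grassmannian of maximal isotropic subspaces: the `n`-dimensional subspaces of `V` on which
`β` is identically zero. -/
def isoGrass (n : ℕ) (β : LinearMap.BilinForm ℂ V) : Set (Submodule ℂ V) :=
  {H | finrank ℂ H = n ∧ ∀ x ∈ H, ∀ y ∈ H, β x y = 0}

/-- The Schubert variety `X_μ`:
`dim (H ∩ ⟨e_{μ_j}, …, e_n⟩) ≥ j` for `1 ≤ j ≤ n`. -/
def schubert (β : LinearMap.BilinForm ℂ V) (e : Basis (Idx n) ℂ V) (mu : SY n) :
    Set (Submodule ℂ V) :=
  {H | H ∈ isoGrass n β ∧ ∀ j : Fin n,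
    (j : ℕ) + 1 ≤ finrank ℂ ↥(H ⊓ Submodule.span ℂ (e '' {i | mu.seq j ≤ i}))}

/-- The opposite Schubert variety `X'_{λᶜ}`, as a function of `λ`:
`dim (H ∩ ⟨e_{-n}, …, e_{λ_j}⟩) ≥ n + 1 - j` for `1 ≤ j ≤ n`. -/
def schubertOpp (β : LinearMap.BilinForm ℂ V) (e : Basis (Idx n) ℂ V) (lam : SY n) :
    Set (Submodule ℂ V) :=
  {H | H ∈ isoGrass n β ∧ ∀ j : Fin n,
    n + 1 - ((j : ℕ) + 1) ≤ finrank ℂ ↥(H ⊓ Submodule.span ℂ (e '' {i | i ≤ lam.seq j}))}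

/-- The special Schubert variety `X_K`: the maximal isotropic subspaces that meet `K`
nontrivially. -/
def specialSchubert (n : ℕ) (β : LinearMap.BilinForm ℂ V) (K : Submodule ℂ V) :
    Set (Submodule ℂ V) :=
  {H | H ∈ isoGrass n β ∧ H ⊓ K ≠ ⊥}

/-! ### The forms `α_j`, `β_d` and their zero locus -/

open Classical in
/-- The projection of `V` to the span of the `e_i` with `|i| ∈ S` along the other basis vectors. -/
noncomputable def coordProj (e : Basis (Idx n) ℂ V) (S : Set ℤ) (x : V) : V :=
  ∑ i : Idx n, if |(i : ℤ)| ∈ S then e.repr x i • e i else 0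

/-- The quadratic form `β_d`: the restriction of `β` to
`V_d = ⟨e_k, e_{-k} | k ∈ col(d)⟩`, composed with the projection of `V` to `V_d`. -/
noncomputable def betaComp (β : LinearMap.BilinForm ℂ V) (e : Basis (Idx n) ℂ V) {lam mu : SY n}
    (d : Component lam mu) (x : V) : ℂ :=
  β (coordProj e d.col x) (coordProj e d.col x)

/-- `Z_{λ/μ}`: the common zero locus of the linear forms `α_j = x_{-λ_j}` for `λ_j = μ_j`,
of `α_0 = x_0` if no component of `λ/μ` meets the first column, and of the `β_d` for all components
`d` of `λ/μ`. -/
def zeroLocus (β : LinearMap.BilinForm ℂ V) (e : Basis (Idx n) ℂ V) (lam mu : SY n) : Set V :=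
  {x | (∀ j, lam.seq j = mu.seq j → e.repr x (lam.seq j).bar = 0) ∧
    ((∀ d : Component lam mu, (1 : ℤ) ∉ d.columns) → e.repr x (Idx.zero n) = 0) ∧
    ∀ d : Component lam mu, betaComp β e d x = 0}

/-- The lines (one-dimensional subspaces of `V`) that are contained in `A`. -/
def linesIn (A : Set V) : Set (Projectivization ℂ V) :=
  {l | ∀ x ∈ l.submodule, x ∈ A}

/-! ### General lines -/

/-- Zariski closed subsets of the projective space `ℙ(V)`: the common zero loci of sets of
homogeneous polynomials in the coordinates of `V`. -/
def IsZariskiClosed (e : Basis (Idx n) ℂ V) (T : Set (Projectivization ℂ V)) : Prop :=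
  ∃ S : Set (MvPolynomial (Idx n) ℂ), (∀ p ∈ S, ∃ k : ℕ, p.IsHomogeneous k) ∧
    T = {l | ∀ p ∈ S, ∀ x ∈ l.submodule, MvPolynomial.eval (fun i => e.repr x i) p = 0}

/-- A general member of the family of lines `A` satisfies `P`: all members of `A` in some Zariski
open subset of `A` that is Zariski dense in `A` satisfy `P`. -/
def GeneralLine (e : Basis (Idx n) ℂ V) (A : Set (Projectivization ℂ V))
    (P : Projectivization ℂ V → Prop) : Prop :=
  ∃ T : Set (Projectivization ℂ V), IsZariskiClosed e T ∧
    (∀ T' : Set (Projectivization ℂ V), IsZariskiClosed e T' → A \ T ⊆ T' → A ⊆ T') ∧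
    ∀ l ∈ A \ T, P l

end IsotropicPieri

namespace IsotropicPieri

open Module

variable {n : ℕ}

/-! ### Gaps crossed by the intervals `[μ_j, λ_j]` -/

/-! Call the gap between `g` and `g + 1` crossed when some interval `[μ_j, λ_j]` contains both.
Crossed gaps are symmetric under `g ↦ -g - 1` (`crosses_neg_iff`), and each `col(d)` is a maximal
run of them in the nonnegative range (`Component.exists_col_eq`). Hence the quadrics defining
`Z_{λ/μ}`, given the linear equations, say exactly that the partial sums of `x_i x_{-i}` over `i ≤
g` vanish at every uncrossed `g` (`mem_zeroLocus_iff`).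

A space `H` in both Schubert varieties should be spanned by vectors supported on the intervals
`[μ_j, λ_j]`, and consecutive intervals meet in at most an endpoint. So a vector `v` of `H` splits
into such pieces, and the splitting is forced except for the coordinate at a shared endpoint `λ_k =
μ_{k-1}`. There, isotropy decides: the tail of `v` on the intervals from index `k` on must be
orthogonal to `v`, which fixes its last coefficient when the coordinate of `v` at `-λ_k` is nonzero.
Thus `H` contains all tails (`tailVec_mem`). Conversely, the tails span an isotropic space
(`sum_tailCoeff_mul`) that satisfies both Schubert conditions, of dimension `n` when the leading
coefficients are nonzero (`inter_eq_singleton`).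

The genericity needed is the nonvanishing of one homogeneous polynomial, `genericPoly`. Its density
in `Z_{λ/μ}` is proved factor by factor, without irreducibility of `Z_{λ/μ}`: from each point of a
dense open subset, a polynomial curve inside `Z_{λ/μ}` reaches a point where the factor is nonzero
(`DenseNonvanishing.of_curve`, `GapEquations.moved`). -/

/-- Some interval `[μ_j, λ_j]` contains both `g` and `g + 1`. -/
def Crosses (lam mu : SY n) (g : ℤ) : Prop :=
  ∃ j, (mu.seq j : ℤ) ≤ g ∧ g < (lam.seq j : ℤ)

lemma SY.image_natAbs (lam : SY n) :
    (Finset.univ.image fun j => (lam.seq j : ℤ).natAbs) = Finset.Icc 1 n := by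
  have h := lam.range_natAbs
  apply Finset.coe_injective
  rw [Finset.coe_image, Finset.coe_univ, Set.image_univ, h, Finset.coe_Icc]

lemma SY.natAbs_injective (lam : SY n) :
    Function.Injective fun j => (lam.seq j : ℤ).natAbs := by
  have h := lam.image_natAbs
  have hc : (Finset.univ.image fun j => (lam.seq j : ℤ).natAbs).card
      = (Finset.univ : Finset (Fin n)).card := by
    rw [h]; simp
  have := Finset.card_image_iff.mp hc
  simpa using this

lemma SY.seq_ne_zero (lam : SY n) (j : Fin n) : (lam.seq j : ℤ) ≠ 0 := by
  have h : (lam.seq j : ℤ).natAbs ∈ Set.Icc 1 n := by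
    rw [← lam.range_natAbs]; exact ⟨j, rfl⟩
  have := h.1
  omega

lemma SY.seq_add_ne_zero (lam : SY n) (j k : Fin n) :
    (lam.seq j : ℤ) + (lam.seq k : ℤ) ≠ 0 := by
  intro h
  have hjk : j = k := lam.natAbs_injective (by simp only; omega)
  subst hjk
  exact lam.seq_ne_zero j (by omega)

lemma SY.exists_seq_eq_or (lam : SY n) {a : ℤ} (h0 : a ≠ 0) (h1 : -(n : ℤ) ≤ a)
    (h2 : a ≤ n) : ∃ j, (lam.seq j : ℤ) = a ∨ (lam.seq j : ℤ) = -a := by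
  have h : a.natAbs ∈ Set.range fun j => (lam.seq j : ℤ).natAbs := by
    rw [lam.range_natAbs]; constructor <;> omega
  obtain ⟨j, hj⟩ := h
  exact ⟨j, Int.natAbs_eq_natAbs_iff.mp hj⟩

lemma SY.seq_lt_seq (lam : SY n) {j k : Fin n} (h : j < k) :
    (lam.seq k : ℤ) < (lam.seq j : ℤ) := lam.strictAnti h

lemma SY.card_natAbs_le (lam : SY n) (g : ℕ) :
    (Finset.univ.filter fun j => (lam.seq j : ℤ).natAbs ≤ g).card
      = ((Finset.Icc 1 n).filter (· ≤ g)).card := by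
  rw [← lam.image_natAbs, Finset.filter_image,
    Finset.card_image_of_injective _ lam.natAbs_injective]

/-- An entry is at least `-g` iff its absolute value is at most `g` or it exceeds `g`. The first
count is the same for all sequences, so `λ` and `μ` have equal count differences at `g` and at `-g -
1`; this gives the symmetry of crossed gaps. -/
lemma SY.card_neg_le (lam : SY n) (g : ℕ) :
    (Finset.univ.filter fun j => -(g : ℤ) - 1 < (lam.seq j : ℤ)).card
      = ((Finset.Icc 1 n).filter (· ≤ g)).card
        + (Finset.univ.filter fun j => (g : ℤ) < (lam.seq j : ℤ)).card := by
  rw [← lam.card_natAbs_le, ← Finset.card_union_of_disjoint]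
  · congr 1
    ext j
    simp only [Finset.mem_filter, Finset.mem_univ, true_and, Finset.mem_union]
    omega
  · rw [Finset.disjoint_filter]
    intro j _ h
    omega

/-- As `μ_j ≤ λ_j`, the positions where `μ` exceeds `g` are among those where `λ` does; a crossing
is a position in the difference. -/
lemma crosses_iff_card {lam mu : SY n} (h : IsSkewRow lam mu) (g : ℤ) :
    Crosses lam mu g ↔ (Finset.univ.filter fun j => g < (mu.seq j : ℤ)).card
      < (Finset.univ.filter fun j => g < (lam.seq j : ℤ)).card := by
  have hle : ∀ j, (mu.seq j : ℤ) ≤ lam.seq j := fun j => h.1 j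
  have hsub : (Finset.univ.filter fun j => g < (mu.seq j : ℤ))
      ⊆ Finset.univ.filter fun j => g < (lam.seq j : ℤ) := by
    intro j
    simp only [Finset.mem_filter, Finset.mem_univ, true_and]
    intro hj
    exact hj.trans_le (hle j)
  constructor
  · rintro ⟨j, h1, h2⟩
    refine Finset.card_lt_card ((Finset.ssubset_iff_of_subset hsub).mpr ⟨j, ?_, ?_⟩)
    · simpa using h2
    · simpa using h1
  · intro hc
    by_contra hn
    refine absurd (Finset.card_le_card (s := Finset.univ.filter fun j => g < (lam.seq j : ℤ))
      (t := Finset.univ.filter fun j => g < (mu.seq j : ℤ)) ?_) (not_le.mpr hc)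
    intro j
    simp only [Finset.mem_filter, Finset.mem_univ, true_and]
    intro hj
    by_contra hm
    exact hn ⟨j, not_lt.mp hm, hj⟩

lemma crosses_neg_iff {lam mu : SY n} (h : IsSkewRow lam mu) (g : ℤ) :
    Crosses lam mu (-g - 1) ↔ Crosses lam mu g := by
  have key : ∀ g : ℕ, Crosses lam mu (-(g : ℤ) - 1) ↔ Crosses lam mu g := by
    intro g
    rw [crosses_iff_card h, crosses_iff_card h, lam.card_neg_le, mu.card_neg_le]
    omega
  rcases le_or_gt 0 g with hg | hg
  · lift g to ℕ using hg
    exact key g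
  · obtain ⟨m, hm⟩ : ∃ m : ℕ, (m : ℤ) = -g - 1 := ⟨(-g - 1).toNat, by omega⟩
    have hg' : g = -(m : ℤ) - 1 := by omega
    rw [← hm, hg']
    exact (key m).symm

lemma not_crosses_of_le {lam mu : SY n} {g : ℤ} (hg : (n : ℤ) ≤ g) : ¬ Crosses lam mu g := by
  rintro ⟨j, -, h⟩
  have := (lam.seq j).2.2
  omega

lemma seq_le_seq_of_lt {lam mu : SY n} (h : IsSkewRow lam mu) {j k : Fin n} (hjk : j < k) :
    (lam.seq k : ℤ) ≤ (mu.seq j : ℤ) := by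
  have hj1 : (j : ℕ) + 1 < n := by have := k.2; have : (j : ℕ) < k := hjk; omega
  have h1 : lam.seq ⟨j + 1, hj1⟩ ≤ mu.seq j := h.2 j ⟨j + 1, hj1⟩ rfl
  have h2 : lam.seq k ≤ lam.seq ⟨j + 1, hj1⟩ := lam.strictAnti.antitone hjk
  exact h2.trans h1

/-- An index next to no crossed gap is, up to sign, a common entry of `λ` and `μ` in the
same position. -/
lemma exists_seq_eq_of_not_crosses {lam mu : SY n} (h : IsSkewRow lam mu) {a : ℤ}
    (h0 : a ≠ 0) (h1 : -(n : ℤ) ≤ a) (h2 : a ≤ n) (ha : ¬ Crosses lam mu a)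
    (ha' : ¬ Crosses lam mu (a - 1)) :
    ∃ j, lam.seq j = mu.seq j ∧ ((lam.seq j : ℤ) = a ∨ (lam.seq j : ℤ) = -a) := by
  obtain ⟨j, hj⟩ := lam.exists_seq_eq_or h0 h1 h2
  refine ⟨j, ?_, hj⟩
  have hle : (mu.seq j : ℤ) ≤ lam.seq j := h.1 j
  have hc : ¬ Crosses lam mu ((lam.seq j : ℤ) - 1) := by
    rcases hj with hj | hj
    · rwa [hj]
    · rw [hj, crosses_neg_iff h]; exact ha
  apply Subtype.ext
  by_contra hne
  exact hc ⟨j, by omega, by omega⟩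

/-! ### The columns of a component -/

lemma mem_skewDiagram_iff {lam mu : SY n} {b : Fin n × ℤ} :
    b ∈ skewDiagram lam mu ↔
      1 ≤ b.2 ∧ (mu.seq b.1 : ℤ) ≤ b.2 - 1 ∧ b.2 - 1 < (lam.seq b.1 : ℤ) := by
  simp only [skewDiagram, diagram, Set.mem_sdiff, Set.mem_ofPred_eq]
  omega

lemma crosses_of_mem_skewDiagram {lam mu : SY n} (b : skewDiagram lam mu) :
    Crosses lam mu (b.1.2 - 1) :=
  ⟨b.1.1, (mem_skewDiagram_iff.mp b.2).2⟩

lemma exists_box {lam mu : SY n} {c : ℤ} (hc : 1 ≤ c) (h : Crosses lam mu (c - 1)) :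
    ∃ b : skewDiagram lam mu, b.1.2 = c := by
  obtain ⟨j, hj⟩ := h
  exact ⟨⟨(j, c), mem_skewDiagram_iff.mpr ⟨hc, hj⟩⟩, rfl⟩

/-- Interlacing puts the right-hand box in the same row or the row directly above; a row strictly
between the two would violate the strict decrease of `λ`. So components can be read off from columns
alone. -/
lemma boxGraph_adj_of_succ {lam mu : SY n} (h : IsSkewRow lam mu) {a b : skewDiagram lam mu}
    (hab : b.1.2 = a.1.2 + 1) : (boxGraph lam mu).Adj a b := by
  have ha := mem_skewDiagram_iff.mp a.2
  have hb := mem_skewDiagram_iff.mp b.2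
  refine ⟨fun e => by rw [e] at hab; omega, ?_, ?_⟩
  · have h1 : ¬ a.1.1 < b.1.1 := fun hlt => by
      have := seq_le_seq_of_lt h hlt
      omega
    have h2 : (a.1.1 : ℕ) ≤ (b.1.1 : ℕ) + 1 := by
      by_contra hlt
      have hk : (b.1.1 : ℕ) + 1 < n := by have := a.1.1.2; omega
      have e1 := seq_le_seq_of_lt h (j := b.1.1) (k := ⟨b.1.1 + 1, hk⟩)
        (Fin.lt_def.mpr (by simp))
      have e2 := lam.seq_lt_seq (j := ⟨b.1.1 + 1, hk⟩) (k := a.1.1)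
        (Fin.lt_def.mpr (by simp only; omega))
      have e3 := seq_le_seq_of_lt h (j := ⟨b.1.1 + 1, hk⟩) (k := a.1.1)
        (Fin.lt_def.mpr (by simp only; omega))
      have e4 : (mu.seq ⟨b.1.1 + 1, hk⟩ : ℤ) ≤ lam.seq ⟨b.1.1 + 1, hk⟩ := h.1 _
      have e5 : (mu.seq ⟨b.1.1 + 1, hk⟩ : ℤ) < mu.seq b.1.1 := mu.seq_lt_seq
        (Fin.lt_def.mpr (by simp))
      omega
    have h3 : (b.1.1 : ℕ) ≤ a.1.1 := not_lt.mp h1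
    rw [abs_le]; omega
  · rw [hab, abs_le]; omega

lemma Component.succ_mem_columns {lam mu : SY n} (h : IsSkewRow lam mu) {d : Component lam mu}
    {c : ℤ} (hc : c ∈ d.columns) (hx : Crosses lam mu c) : c + 1 ∈ d.columns := by
  obtain ⟨b, hb, rfl⟩ := hc
  have := mem_skewDiagram_iff.mp b.2
  obtain ⟨b', hb'⟩ := exists_box (lam := lam) (mu := mu) (c := b.1.2 + 1) (by omega)
    (by simpa using hx)
  refine ⟨b', ?_, hb'⟩
  rw [← hb]
  exact (SimpleGraph.ConnectedComponent.sound (boxGraph_adj_of_succ h hb').reachable).symm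

lemma Component.pred_mem_columns {lam mu : SY n} (h : IsSkewRow lam mu) {d : Component lam mu}
    {c : ℤ} (hc : c ∈ d.columns) (h1 : 1 ≤ c - 1) (hx : Crosses lam mu (c - 1 - 1)) :
    c - 1 ∈ d.columns := by
  obtain ⟨b, hb, rfl⟩ := hc
  obtain ⟨b', hb'⟩ := exists_box (lam := lam) (mu := mu) (c := b.1.2 - 1) h1 hx
  refine ⟨b', ?_, hb'⟩
  rw [← hb]
  exact SimpleGraph.ConnectedComponent.sound
    (boxGraph_adj_of_succ h (by omega : b.1.2 = b'.1.2 + 1)).reachable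

/-- The set `col(d)` is a maximal interval of nonnegative integers whose gaps are all crossed. -/
lemma Component.exists_col_eq {lam mu : SY n} (h : IsSkewRow lam mu) (d : Component lam mu) :
    ∃ p q : ℤ, 0 ≤ p ∧ p < q ∧ q ≤ n ∧ (p = 0 ∨ ¬ Crosses lam mu (p - 1)) ∧
      ¬ Crosses lam mu q ∧ (∀ c, p ≤ c → c < q → Crosses lam mu c) ∧
      d.columns = Set.Icc (p + 1) q ∧ d.col = Set.Icc p q := by
  have hcol : ∀ c ∈ d.columns, 1 ≤ c ∧ c ≤ n ∧ Crosses lam mu (c - 1) := by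
    rintro _ ⟨b, -, rfl⟩
    have h1 := mem_skewDiagram_iff.mp b.2
    have h2 := (lam.seq b.1.1).2.2
    exact ⟨h1.1, by omega, crosses_of_mem_skewDiagram b⟩
  have hne : d.columns.Nonempty := by
    induction d using SimpleGraph.ConnectedComponent.ind with
    | _ v => exact ⟨v.1.2, v, rfl, rfl⟩
  obtain ⟨c₀, hc₀⟩ := hne
  have hb₀ := hcol c₀ hc₀
  -- The run of columns around `c₀` is extended as far as possible in both directions, to `[r, q]`.
  obtain ⟨q, hq, hqmax⟩ := Int.exists_greatest_of_bdd
    (P := fun q => c₀ ≤ q ∧ ∀ c, c₀ ≤ c → c ≤ q → c ∈ d.columns)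
    ⟨n, fun z hz => (hcol z (hz.2 z hz.1 le_rfl)).2.1⟩
    ⟨c₀, le_rfl, fun c h1 h2 => by rwa [le_antisymm h2 h1]⟩
  obtain ⟨r, hr, hrmin⟩ := Int.exists_least_of_bdd
    (P := fun r => r ≤ c₀ ∧ ∀ c, r ≤ c → c ≤ c₀ → c ∈ d.columns)
    ⟨1, fun z hz => (hcol z (hz.2 z le_rfl hz.1)).1⟩
    ⟨c₀, le_rfl, fun c h1 h2 => by rwa [le_antisymm h2 h1]⟩
  have hall : ∀ c, r ≤ c → c ≤ q → c ∈ d.columns := fun c h1 h2 => by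
    rcases le_total c c₀ with h3 | h3
    · exact hr.2 c h1 h3
    · exact hq.2 c h3 h2
  have hrq : r ≤ q := hr.1.trans hq.1
  have hqc : ¬ Crosses lam mu q := fun hx => by
    have hm := Component.succ_mem_columns h (hall q hrq le_rfl) hx
    have := hqmax (q + 1) ⟨by omega, fun c h1 h2 => by
      rcases eq_or_lt_of_le h2 with h3 | h3
      · rwa [h3]
      · exact hq.2 c h1 (by omega)⟩
    omega
  have hrc : r = 1 ∨ ¬ Crosses lam mu (r - 1 - 1) := by
    by_contra hcon
    push Not at hcon
    have hr1 := (hcol r (hall r le_rfl hrq)).1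
    have hm := Component.pred_mem_columns h (hall r le_rfl hrq) (by omega) hcon.2
    have := hrmin (r - 1) ⟨by omega, fun c h1 h2 => by
      rcases eq_or_lt_of_le h1 with h3 | h3
      · rwa [← h3]
      · exact hr.2 c (by omega) h2⟩
    omega
  have hcols : d.columns = Set.Icc r q := by
    refine Set.Subset.antisymm ?_ fun c hc => hall c hc.1 hc.2
    rintro _ ⟨b, hb, rfl⟩
    obtain ⟨b₀, hd₀, hb₀c⟩ := hc₀
    have hreach : (boxGraph lam mu).Reachable b₀ b :=
      SimpleGraph.ConnectedComponent.exact (hd₀.trans hb.symm)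
    rw [SimpleGraph.reachable_iff_reflTransGen] at hreach
    clear hb
    -- Each step along a path changes the column by at most one, so leaving `[r, q]` would need a
    -- box in column `r - 1` or `q + 1`. Neither has one: the gap there is uncrossed, or the column
    -- is 0.
    induction hreach with
    | refl => exact ⟨by rw [hb₀c]; exact hr.1, by rw [hb₀c]; exact hq.1⟩
    | tail _ hadj ih =>
      rename_i x y _
      obtain ⟨-, -, h3⟩ := hadj
      rw [abs_le] at h3
      have hy := crosses_of_mem_skewDiagram y
      have hy1 := (mem_skewDiagram_iff.mp y.2).1
      obtain ⟨i1, i2⟩ := ih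
      constructor
      · by_contra hlt
        have e : y.1.2 - 1 = r - 1 - 1 := by omega
        rw [e] at hy
        rcases hrc with hrc | hrc
        · omega
        · exact hrc hy
      · by_contra hlt
        have e : y.1.2 - 1 = q := by omega
        rw [e] at hy
        exact hqc hy
  have hr1 := (hcol r (hall r le_rfl hrq)).1
  refine ⟨r - 1, q, by omega, by omega, (hcol q (hall q hrq le_rfl)).2.1, ?_, hqc, ?_, ?_, ?_⟩
  · exact hrc.imp (fun h => by omega) id
  · intro c h1 h2
    have := (hcol (c + 1) (hall _ (by omega) (by omega))).2.2
    simpa using this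
  · rw [hcols]; congr 1; omega
  · ext c
    have hleast : IsLeast d.columns (c + 1) ↔ c + 1 = r := by
      rw [hcols]
      exact ⟨fun hl => hl.unique (isLeast_Icc hrq), fun e => by rw [e]; exact isLeast_Icc hrq⟩
    show (c ∈ d.columns ∨ IsLeast d.columns (c + 1)) ↔ _
    rw [hleast, hcols, Set.mem_Icc, Set.mem_Icc]
    omega

/-! ### Coordinates -/

@[simp] lemma Idx.coe_bar (i : Idx n) : ((i.bar : Idx n) : ℤ) = -(i : ℤ) := rfl

@[simp] lemma Idx.bar_bar (i : Idx n) : i.bar.bar = i := Subtype.ext (neg_neg _)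

@[simp] lemma Idx.coe_zero : ((Idx.zero n : Idx n) : ℤ) = 0 := rfl

/-- Negation of indices as a permutation. -/
def Idx.barEquiv (n : ℕ) : Idx n ≃ Idx n where
  toFun := Idx.bar
  invFun := Idx.bar
  left_inv := Idx.bar_bar
  right_inv := Idx.bar_bar

lemma Idx.sum_bar {M : Type*} [AddCommMonoid M] (f : Idx n → M) :
    ∑ i : Idx n, f i.bar = ∑ i, f i :=
  (Idx.barEquiv n).sum_comp f

/-- The partial sum of the terms `y_a y_{-a}` of the quadratic form over `a ≤ g`. -/
noncomputable def pairSum (y : Idx n → ℂ) (g : ℤ) : ℂ :=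
  ∑ i : Idx n, if (i : ℤ) ≤ g then y i * y i.bar else 0

lemma pairSum_of_le (y : Idx n → ℂ) {g : ℤ} (hg : (n : ℤ) ≤ g) :
    pairSum y g = ∑ i, y i * y i.bar := by
  refine Finset.sum_congr rfl fun i _ => if_pos (i.2.2.trans hg)

/-- Negating indices turns the range `i ≤ -g - 1` into `i > g` and preserves the products. -/
lemma pairSum_add_neg (y : Idx n → ℂ) (g : ℤ) :
    pairSum y g + pairSum y (-g - 1) = ∑ i, y i * y i.bar := by
  unfold pairSum
  rw [← Idx.sum_bar (fun i => if (i : ℤ) ≤ -g - 1 then y i * y i.bar else 0),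
    ← Finset.sum_add_distrib]
  refine Finset.sum_congr rfl fun i _ => ?_
  rw [Idx.coe_bar, Idx.bar_bar]
  by_cases h : (i : ℤ) ≤ g
  · rw [if_pos h, if_neg (by omega), add_zero]
  · rw [if_neg h, if_pos (by omega), zero_add, mul_comm]

lemma pairSum_eq_add (y : Idx n → ℂ) (i : Idx n) :
    pairSum y i = pairSum y (i - 1) + y i * y i.bar := by
  unfold pairSum
  have : y i * y i.bar = ∑ k : Idx n, if k = i then y k * y k.bar else 0 := by simp
  rw [this, ← Finset.sum_add_distrib]
  refine Finset.sum_congr rfl fun k _ => ?_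
  rcases lt_trichotomy (k : ℤ) i with h | h | h
  · rw [if_pos h.le, if_pos (by omega), if_neg (by rintro rfl; omega), add_zero]
  · rw [if_pos h.le, if_neg (by omega), if_pos (Subtype.ext h), zero_add]
  · rw [if_neg (by omega), if_neg (by omega), if_neg (by rintro rfl; omega), add_zero]

/-- The equations of `Z_{λ/μ}` in terms of the gaps that no interval `[μ_j, λ_j]` crosses. -/
structure GapEquations (lam mu : SY n) (y : Idx n → ℂ) : Prop where
  bar_eq_zero : ∀ j, lam.seq j = mu.seq j → y (lam.seq j).bar = 0
  zero_eq_zero : ¬ Crosses lam mu 0 → y (Idx.zero n) = 0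
  pairSum_eq_zero : ∀ g, ¬ Crosses lam mu g → pairSum y g = 0

/-! ### Equivalence of the equations of `Z_{λ/μ}` with the gap equations -/

section
variable {V : Type*} [AddCommGroup V] [Module ℂ V]
  {β : LinearMap.BilinForm ℂ V} {e : Basis (Idx n) ℂ V}

lemma IsStandardBasis.apply_eq_sum (he : IsStandardBasis β e) (x y : V) :
    β x y = ∑ i, e.repr x i * e.repr y i.bar := by
  conv_lhs => rw [← e.sum_repr x, ← e.sum_repr y]
  simp only [map_sum, LinearMap.sum_apply, map_smul, LinearMap.smul_apply, smul_eq_mul,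
    Finset.mul_sum]
  rw [Finset.sum_comm]
  refine Finset.sum_congr rfl fun i _ => ?_
  rw [Finset.sum_eq_single i.bar]
  · rw [he, if_pos (by simp)]; ring
  · intro j _ hj
    have : ¬ (i : ℤ) = -(j : ℤ) := fun h => hj (Subtype.ext (by rw [Idx.coe_bar]; omega))
    rw [he, if_neg this]; ring
  · simp

open Classical in
lemma repr_coordProj (e : Basis (Idx n) ℂ V) (S : Set ℤ) (x : V) (i : Idx n) :
    e.repr (coordProj e S x) i = if |(i : ℤ)| ∈ S then e.repr x i else 0 := by
  unfold coordProj
  have : ∀ k : Idx n, (if |(k : ℤ)| ∈ S then e.repr x k • e k else 0)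
      = (if |(k : ℤ)| ∈ S then e.repr x k else 0) • e k := fun k => by split_ifs <;> simp
  rw [Finset.sum_congr rfl fun k _ => this k, e.repr_sum_self]

/-- The sum over `p ≤ |i| ≤ q` is the sum over `|i| ≤ q` minus that over `|i| ≤ p - 1`. For `p = 0`
the second bracket would contribute a spurious square of the coordinate 0, so that case is separate.
-/
lemma betaComp_eq (he : IsStandardBasis β e) {lam mu : SY n} (d : Component lam mu)
    {p q : ℤ} (hp : 0 < p) (hpq : p < q) (hd : d.col = Set.Icc p q) (x : V) :
    betaComp β e d x = (pairSum (e.repr x) q - pairSum (e.repr x) (-q - 1))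
      - (pairSum (e.repr x) (p - 1) - pairSum (e.repr x) (-p)) := by
  unfold betaComp pairSum
  rw [he.apply_eq_sum, ← Finset.sum_sub_distrib, ← Finset.sum_sub_distrib,
    ← Finset.sum_sub_distrib]
  refine Finset.sum_congr rfl fun i _ => ?_
  rw [repr_coordProj, repr_coordProj, hd, Idx.coe_bar, abs_neg]
  simp only [Set.mem_Icc]
  rcases abs_cases (i : ℤ) with ⟨h, _⟩ | ⟨h, _⟩ <;> rw [h] <;> split_ifs <;> first | omega | ring

lemma betaComp_eq_of_zero (he : IsStandardBasis β e) {lam mu : SY n} (d : Component lam mu)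
    {q : ℤ} (hq : 0 < q) (hd : d.col = Set.Icc 0 q) (x : V) :
    betaComp β e d x = pairSum (e.repr x) q - pairSum (e.repr x) (-q - 1) := by
  unfold betaComp pairSum
  rw [he.apply_eq_sum, ← Finset.sum_sub_distrib]
  refine Finset.sum_congr rfl fun i _ => ?_
  rw [repr_coordProj, repr_coordProj, hd, Idx.coe_bar, abs_neg]
  simp only [Set.mem_Icc]
  rcases abs_cases (i : ℤ) with ⟨h, _⟩ | ⟨h, _⟩ <;> rw [h] <;> split_ifs <;> first | omega | ring

lemma forall_one_notMem_columns_iff {lam mu : SY n} :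
    (∀ d : Component lam mu, (1 : ℤ) ∉ d.columns) ↔ ¬ Crosses lam mu 0 := by
  constructor
  · intro hd hc
    obtain ⟨b, hb⟩ := exists_box (lam := lam) (mu := mu) (c := 1) le_rfl (by simpa using hc)
    exact hd _ ⟨b, rfl, hb⟩
  · rintro hc d ⟨b, -, hb⟩
    have := crosses_of_mem_skewDiagram b
    rw [hb] at this
    exact hc this

/-- With both adjacent gaps uncrossed, `i` is 0 or, up to sign, a common entry of `λ` and `μ`; one
of the linear forms then kills a factor. -/
lemma mul_bar_eq_zero {lam mu : SY n} (h : IsSkewRow lam mu) {y : Idx n → ℂ}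
    (h1 : ∀ j, lam.seq j = mu.seq j → y (lam.seq j).bar = 0)
    (h2 : ¬ Crosses lam mu 0 → y (Idx.zero n) = 0) (i : Idx n)
    (hi : ¬ Crosses lam mu i) (hi' : ¬ Crosses lam mu (i - 1)) : y i * y i.bar = 0 := by
  by_cases h0 : (i : ℤ) = 0
  · obtain rfl : i = Idx.zero n := Subtype.ext h0
    rw [h2 hi, zero_mul]
  · obtain ⟨j, hj, hj' | hj'⟩ := exists_seq_eq_of_not_crosses h h0 i.2.1 i.2.2 hi hi'
    · obtain rfl : lam.seq j = i := Subtype.ext hj'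
      rw [h1 j hj, mul_zero]
    · obtain rfl : (lam.seq j).bar = i := Subtype.ext (by rw [Idx.coe_bar]; omega)
      rw [h1 j hj, zero_mul]

theorem mem_zeroLocus_iff (he : IsStandardBasis β e) {lam mu : SY n} (h : IsSkewRow lam mu)
    (x : V) : x ∈ zeroLocus β e lam mu ↔ GapEquations lam mu (e.repr x) := by
  obtain ⟨y, hy⟩ : ∃ y : Idx n → ℂ, y = e.repr x := ⟨_, rfl⟩
  rw [← hy]
  constructor
  · intro hx
    have h1 : ∀ j, lam.seq j = mu.seq j → y (lam.seq j).bar = 0 := by rw [hy]; exact hx.1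
    have h2 := hx.2.1
    have h3 := hx.2.2
    rw [← hy] at h2
    rw [forall_one_notMem_columns_iff] at h2
    -- This difference is the sum over `|i| ≤ g`. If the gap `g - 1` is crossed, `g` is the last
    -- column of a component, whose form accounts for the terms back to the preceding uncrossed gap;
    -- otherwise the terms at `±g` vanish.
    have key : ∀ g : ℕ, g ≤ n → ¬ Crosses lam mu g →
        pairSum y g - pairSum y (-g - 1) = 0 := by
      intro g
      induction g using Nat.strong_induction_on with
      | _ g ih =>
        intro hgn hg
        by_cases hx : 1 ≤ g ∧ Crosses lam mu ((g : ℤ) - 1)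
        · obtain ⟨b, hb⟩ := exists_box (lam := lam) (mu := mu) (c := g) (by omega) hx.2
          obtain ⟨p, q, hp, hpq, -, hpc, hq, hcr, hcol, hd⟩ :=
            Component.exists_col_eq h ((boxGraph lam mu).connectedComponentMk b)
          have hgm : (g : ℤ) ∈ Component.columns ((boxGraph lam mu).connectedComponentMk b) :=
            ⟨b, rfl, hb⟩
          rw [hcol] at hgm
          obtain rfl : q = g := by
            by_contra hne
            exact hg (hcr g (by have := hgm.1; omega) (lt_of_le_of_ne hgm.2 (Ne.symm hne)))
          have hb := h3 ((boxGraph lam mu).connectedComponentMk b)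
          rcases hp.eq_or_lt with rfl | hp'
          · rwa [betaComp_eq_of_zero he _ hpq hd, ← hy] at hb
          · rw [betaComp_eq he _ hp' hpq hd, ← hy] at hb
            rcases hpc with rfl | hpc
            · exact absurd hp' (lt_irrefl _)
            · lift p to ℕ using hp
              have := ih (p - 1) (by omega) (by omega)
                (by rw [Nat.cast_sub (by omega)]; exact_mod_cast hpc)
              rw [Nat.cast_sub (by omega)] at this
              have e1 : -((p : ℤ) - ((1 : ℕ) : ℤ)) - 1 = -p := by push_cast; ring
              rw [e1, Nat.cast_one] at this
              rw [this, sub_zero] at hb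
              exact hb
        · have hmem : -(n : ℤ) ≤ g ∧ (g : ℤ) ≤ n := by omega
          have hgc : ¬ Crosses lam mu ((g : ℤ) - 1) := by
            intro hc
            rcases Nat.eq_zero_or_pos g with rfl | hpos
            · have e1 : (((0 : ℕ) : ℤ) - 1) = -((0 : ℕ) : ℤ) - 1 := by simp
              rw [e1, crosses_neg_iff h] at hc
              exact hg hc
            · exact hx ⟨hpos, hc⟩
          have hprod := mul_bar_eq_zero h h1 h2 ⟨(g : ℤ), hmem⟩ hg hgc
          have e1 := pairSum_eq_add y ⟨(g : ℤ), hmem⟩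
          have e2 := pairSum_eq_add y (Idx.bar ⟨(g : ℤ), hmem⟩)
          rw [Idx.bar_bar, mul_comm] at e2
          rw [hprod, add_zero] at e1 e2
          simp only [Idx.coe_bar] at e1 e2
          rcases Nat.eq_zero_or_pos g with rfl | hpos
          · rw [e1]; simp
          · have := ih (g - 1) (by omega) (by omega) (by
              rw [Nat.cast_sub (by omega)]; exact_mod_cast hgc)
            rw [Nat.cast_sub (by omega)] at this
            have e3 : -((g : ℤ) - ((1 : ℕ) : ℤ)) - 1 = -g := by push_cast; ring
            rw [e3, Nat.cast_one] at this
            rw [e1, ← e2, this]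
    -- The case `g = n` is the full quadratic form. Its vanishing makes the sum of the two partial
    -- sums zero; as their difference is zero too, each vanishes.
    have htot : ∑ i, y i * y i.bar = 0 := by
      have := key n le_rfl (not_crosses_of_le le_rfl)
      have h0 : pairSum y (-(n : ℤ) - 1) = 0 :=
        Finset.sum_eq_zero fun i _ => if_neg (by have := i.2.1; omega)
      rwa [pairSum_of_le y le_rfl, h0, sub_zero] at this
    have key2 : ∀ g : ℕ, ¬ Crosses lam mu g → pairSum y g = 0 ∧ pairSum y (-g - 1) = 0 := by
      intro g hg
      have hs := pairSum_add_neg y g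
      rw [htot] at hs
      rcases le_or_gt g n with hgn | hgn
      · have hk := key g hgn hg
        constructor
        · linear_combination (hs + hk) / 2
        · linear_combination (hs - hk) / 2
      · have h0 : pairSum y g = 0 := by rw [pairSum_of_le y (by omega), htot]
        rw [h0, zero_add] at hs
        exact ⟨h0, hs⟩
    refine ⟨h1, h2, fun g hg => ?_⟩
    rcases le_or_gt 0 g with hg0 | hg0
    · lift g to ℕ using hg0
      exact (key2 g hg).1
    · obtain ⟨m, hm⟩ : ∃ m : ℕ, (m : ℤ) = -g - 1 := ⟨(-g - 1).toNat, by omega⟩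
      have := (key2 m (by rw [hm, crosses_neg_iff h]; exact hg)).2
      rwa [hm, show -(-g - 1) - 1 = g by ring] at this
  · rintro ⟨h1, h2, h3⟩
    refine ⟨by rw [hy] at h1; exact h1, fun hd => hy ▸ h2 (forall_one_notMem_columns_iff.mp hd),
      fun d => ?_⟩
    obtain ⟨p, q, hp, hpq, -, hpc, hq, -, -, hd⟩ := Component.exists_col_eq h d
    have hq' : ¬ Crosses lam mu (-q - 1) := by rwa [crosses_neg_iff h]
    rcases hp.eq_or_lt with rfl | hp'
    · rw [betaComp_eq_of_zero he d hpq hd, ← hy, h3 q hq, h3 _ hq', sub_zero]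
    · rw [betaComp_eq he d hp' hpq hd, ← hy, h3 q hq, h3 _ hq']
      have hpc : ¬ Crosses lam mu (p - 1) := hpc.resolve_left hp'.ne'
      have hpc' : ¬ Crosses lam mu (-p) := by
        have := crosses_neg_iff h (p - 1)
        rw [show -(p - 1) - 1 = -p by ring] at this
        rwa [this]
      rw [h3 _ hpc, h3 _ hpc']
      simp

end

/-! ### The maximal isotropic subspace through a general vector -/

/-- The right end point of the `k`-th interval `[μ_k, λ_k]` is the left end point of the
preceding interval. -/
def Shared (lam mu : SY n) (k : Fin n) : Prop :=
  ∃ j : Fin n, (k : ℕ) = (j : ℕ) + 1 ∧ (mu.seq j : ℤ) = lam.seq k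

/-- The genericity conditions under which a vector of `Z_{λ/μ}` lies on exactly one maximal
isotropic subspace in the intersection of the two Schubert varieties. -/
structure IsGeneric (lam mu : SY n) (y : Idx n → ℂ) : Prop where
  ne_zero : ∀ k, ¬ Shared lam mu k → y (lam.seq k) ≠ 0
  bar_ne_zero : ∀ k, Shared lam mu k → y (lam.seq k).bar ≠ 0
  pairSum_ne_zero : ∀ k, Shared lam mu k → pairSum y ((lam.seq k : ℤ) - 1) ≠ 0

open Classical in
/-- The part of the coordinate `λ_k` that belongs to the intervals with index at least `k`. -/
noncomputable def splitCoeff (lam mu : SY n) (y : Idx n → ℂ) (k : Fin n) : ℂ :=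
  if Shared lam mu k then -pairSum y ((lam.seq k : ℤ) - 1) / y (lam.seq k).bar
  else y (lam.seq k)

lemma IsGeneric.splitCoeff_ne_zero {lam mu : SY n} {y : Idx n → ℂ} (hy : IsGeneric lam mu y)
    (k : Fin n) : splitCoeff lam mu y k ≠ 0 := by
  unfold splitCoeff
  split_ifs with hk
  · exact div_ne_zero (neg_ne_zero.mpr (hy.pairSum_ne_zero k hk)) (hy.bar_ne_zero k hk)
  · exact hy.ne_zero k hk

/-- Only the immediately preceding interval can touch `λ_k`; for earlier ones the strict decrease of
`λ` leaves room. -/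
lemma lt_of_not_shared {lam mu : SY n} (h : IsSkewRow lam mu) {k : Fin n}
    (hk : ¬ Shared lam mu k) {j : Fin n} (hj : j < k) : (lam.seq k : ℤ) < mu.seq j := by
  refine lt_of_le_of_ne (seq_le_seq_of_lt h hj) fun heq => ?_
  have h1 : (j : ℕ) < k := hj
  rcases Nat.lt_or_ge ((j : ℕ) + 1) k with h2 | h2
  · have hj1 : (j : ℕ) + 1 < n := h2.trans k.2
    have e1 : (lam.seq ⟨j + 1, hj1⟩ : ℤ) ≤ mu.seq j :=
      seq_le_seq_of_lt h (Fin.lt_def.mpr (by simp))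
    have e2 := lam.seq_lt_seq (j := ⟨j + 1, hj1⟩) (k := k) (Fin.lt_def.mpr h2)
    omega
  · exact hk ⟨j, by omega, heq.symm⟩

lemma not_crosses_of_not_shared {lam mu : SY n} (h : IsSkewRow lam mu) {k : Fin n}
    (hk : ¬ Shared lam mu k) : ¬ Crosses lam mu (lam.seq k) := by
  rintro ⟨j, h1, h2⟩
  have hjk : j < k := lam.strictAnti.lt_iff_gt.mp h2
  have := lt_of_not_shared h hk hjk
  omega

/-- This says that the tail from index `k` is orthogonal to the whole vector. At a shared endpoint
it is how the coefficient was chosen; otherwise it is the gap equation at the uncrossed gap `λ_k`.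
-/
lemma splitCoeff_mul {lam mu : SY n} (h : IsSkewRow lam mu) {y : Idx n → ℂ}
    (hy : IsGeneric lam mu y) (hz : GapEquations lam mu y) (k : Fin n) :
    splitCoeff lam mu y k * y (lam.seq k).bar = -pairSum y ((lam.seq k : ℤ) - 1) := by
  unfold splitCoeff
  split_ifs with hk
  · exact div_mul_cancel₀ _ (hy.bar_ne_zero k hk)
  · have h1 := pairSum_eq_add y (lam.seq k)
    rw [hz.pairSum_eq_zero _ (not_crosses_of_not_shared h hk)] at h1
    linear_combination -h1

lemma GapEquations.total_eq_zero {lam mu : SY n} {y : Idx n → ℂ} (hz : GapEquations lam mu y) :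
    ∑ i, y i * y i.bar = 0 := by
  rw [← pairSum_of_le y le_rfl]
  exact hz.pairSum_eq_zero _ (not_crosses_of_le le_rfl)

/-- Vectors of `Z_{λ/μ}` are supported on the union of the intervals `[μ_j, λ_j]`. -/
lemma GapEquations.eq_zero {lam mu : SY n} (h : IsSkewRow lam mu) {y : Idx n → ℂ}
    (hz : GapEquations lam mu y) (i : Idx n)
    (hi : ∀ j, ¬ ((mu.seq j : ℤ) ≤ i ∧ (i : ℤ) ≤ lam.seq j)) : y i = 0 := by
  have h1 : ¬ Crosses lam mu i := fun ⟨j, a, b⟩ => hi j ⟨a, b.le⟩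
  have h2 : ¬ Crosses lam mu ((i : ℤ) - 1) := fun ⟨j, a, b⟩ => hi j ⟨by omega, by omega⟩
  by_cases h0 : (i : ℤ) = 0
  · obtain rfl : i = Idx.zero n := Subtype.ext h0
    exact hz.zero_eq_zero h1
  · obtain ⟨j, hj, hj' | hj'⟩ := exists_seq_eq_of_not_crosses h h0 i.2.1 i.2.2 h1 h2
    · exact absurd ⟨by rw [← hj]; exact hj'.le, hj'.ge⟩ (hi j)
    · obtain rfl : (lam.seq j).bar = i := Subtype.ext (by rw [Idx.coe_bar]; omega)
      exact hz.bar_eq_zero j hj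

/-- The coordinates of the part of a vector that belongs to the intervals with index at
least `k`. -/
noncomputable def tailCoeff (lam mu : SY n) (y : Idx n → ℂ) (k : ℕ) (i : Idx n) : ℂ :=
  if h : k < n then
    if (i : ℤ) < lam.seq ⟨k, h⟩ then y i
    else if (i : ℤ) = lam.seq ⟨k, h⟩ then splitCoeff lam mu y ⟨k, h⟩ else 0
  else 0

lemma tailCoeff_of_lt {lam mu : SY n} {y : Idx n → ℂ} {k : Fin n} {i : Idx n}
    (hi : (i : ℤ) < lam.seq k) : tailCoeff lam mu y k i = y i := by
  rw [tailCoeff, dif_pos k.2, if_pos hi]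

lemma tailCoeff_of_eq {lam mu : SY n} {y : Idx n → ℂ} {k : Fin n} {i : Idx n}
    (hi : (i : ℤ) = lam.seq k) : tailCoeff lam mu y k i = splitCoeff lam mu y k := by
  rw [tailCoeff, dif_pos k.2, if_neg (by simp [hi]), if_pos hi]

lemma tailCoeff_of_gt {lam mu : SY n} {y : Idx n → ℂ} {k : Fin n} {i : Idx n}
    (hi : (lam.seq k : ℤ) < i) : tailCoeff lam mu y k i = 0 := by
  rw [tailCoeff, dif_pos k.2, if_neg (by simp only [Fin.eta]; omega),
    if_neg (by simp only [Fin.eta]; omega)]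

lemma tailCoeff_of_le {lam mu : SY n} {y : Idx n → ℂ} {k : ℕ} (hk : n ≤ k) (i : Idx n) :
    tailCoeff lam mu y k i = 0 := by
  rw [tailCoeff, dif_neg (by omega)]

lemma tailCoeff_zero {lam mu : SY n} (h : IsSkewRow lam mu) {y : Idx n → ℂ}
    (hz : GapEquations lam mu y) : tailCoeff lam mu y 0 = y := by
  funext i
  rcases Nat.eq_zero_or_pos n with rfl | hn
  · rw [tailCoeff_of_le le_rfl, hz.eq_zero h i fun j => j.elim0]
  · have hs : ¬ Shared lam mu ⟨0, hn⟩ := by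
      rintro ⟨j, hj, -⟩
      simp at hj
    rcases lt_trichotomy (i : ℤ) (lam.seq ⟨0, hn⟩) with hi | hi | hi
    · exact tailCoeff_of_lt (k := ⟨0, hn⟩) hi
    · rw [tailCoeff_of_eq (k := ⟨0, hn⟩) hi, splitCoeff, if_neg hs, ← Subtype.ext hi]
    · rw [tailCoeff_of_gt (k := ⟨0, hn⟩) hi, hz.eq_zero h i]
      rintro j ⟨-, hj⟩
      have : lam.seq j ≤ lam.seq ⟨0, hn⟩ :=
        lam.strictAnti.antitone (Fin.le_def.mpr (Nat.zero_le _))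
      have : (lam.seq j : ℤ) ≤ lam.seq ⟨0, hn⟩ := this
      omega

/-- The part of a vector outside the intervals with index larger than `j` is supported
above `μ_j`. -/
lemma tailCoeff_succ_eq {lam mu : SY n} (h : IsSkewRow lam mu) {y : Idx n → ℂ}
    (hz : GapEquations lam mu y) (j : Fin n) {i : Idx n} (hi : (i : ℤ) < mu.seq j) :
    tailCoeff lam mu y (j + 1) i = y i := by
  have hval : ∀ hi' : ∀ m, j < m → (lam.seq m : ℤ) < i, y i = 0 := fun hi' => by
    refine hz.eq_zero h i fun m => ?_
    rintro ⟨h1, h2⟩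
    rcases lt_or_ge j m with hm | hm
    · have := hi' m hm
      omega
    · have : mu.seq j ≤ mu.seq m := mu.strictAnti.antitone hm
      have : (mu.seq j : ℤ) ≤ mu.seq m := this
      omega
  by_cases hj : (j : ℕ) + 1 < n
  · rcases lt_trichotomy (i : ℤ) (lam.seq ⟨j + 1, hj⟩) with hi' | hi' | hi'
    · exact tailCoeff_of_lt (k := ⟨j + 1, hj⟩) hi'
    · rw [tailCoeff_of_eq (k := ⟨j + 1, hj⟩) hi', splitCoeff, if_neg, ← Subtype.ext hi']
      rintro ⟨m, hm, hm'⟩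
      obtain rfl : j = m := Fin.ext (by simpa using hm)
      omega
    · rw [tailCoeff_of_gt (k := ⟨j + 1, hj⟩) hi', hval]
      intro m hm
      refine lt_of_le_of_lt ?_ hi'
      exact lam.strictAnti.antitone (Fin.le_def.mpr hm)
  · rw [tailCoeff_of_le (by omega), hval]
    intro m hm
    have : (j : ℕ) < m := hm
    omega

/-- If `λ_k + λ_l < 0`, no `i` satisfies both `i ≤ λ_k` and `-i ≤ λ_l`. Otherwise the sum runs from
`-λ_l` to `λ_k`, with split coefficients at the two ends; `splitCoeff_mul` replaces the end terms by
partial sums, and everything collapses to minus the full quadratic form. -/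
lemma sum_tailCoeff_mul {lam mu : SY n} (h : IsSkewRow lam mu) {y : Idx n → ℂ}
    (hy : IsGeneric lam mu y) (hz : GapEquations lam mu y) (k l : Fin n) :
    ∑ i : Idx n, tailCoeff lam mu y k i * tailCoeff lam mu y l i.bar = 0 := by
  rcases lt_or_gt_of_ne (lam.seq_add_ne_zero k l) with hkl | hkl
  · refine Finset.sum_eq_zero fun i _ => ?_
    rcases lt_or_ge (lam.seq k : ℤ) i with hi | hi
    · rw [tailCoeff_of_gt hi, zero_mul]
    · rw [tailCoeff_of_gt (k := l) (i := i.bar) (by rw [Idx.coe_bar]; omega), mul_zero]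
  · have hterm : ∀ i : Idx n, tailCoeff lam mu y k i * tailCoeff lam mu y l i.bar =
        (if (i : ℤ) ≤ (lam.seq k : ℤ) - 1 then y i * y i.bar else 0)
        - (if (i : ℤ) ≤ -((lam.seq l : ℤ) - 1) - 1 then y i * y i.bar else 0)
        + (if i = lam.seq k then splitCoeff lam mu y k * y i.bar else 0)
        + (if i = (lam.seq l).bar then splitCoeff lam mu y l * y i else 0) := by
      intro i
      have e1 : i = lam.seq k ↔ (i : ℤ) = lam.seq k := Subtype.ext_iff
      have e2 : i = (lam.seq l).bar ↔ (i : ℤ) = -lam.seq l := Subtype.ext_iff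
      simp only [e1, e2]
      rcases lt_trichotomy (i : ℤ) (lam.seq k) with hi | hi | hi
      · rw [tailCoeff_of_lt hi]
        rcases lt_trichotomy (-(i : ℤ)) (lam.seq l) with hl | hl | hl
        · rw [tailCoeff_of_lt (k := l) (i := i.bar) hl]
          rw [if_pos (by omega), if_neg (by omega), if_neg (by omega), if_neg (by omega)]
          ring
        · rw [tailCoeff_of_eq (k := l) (i := i.bar) hl]
          rw [if_pos (by omega), if_pos (by omega), if_neg (by omega), if_pos (by omega)]
          ring
        · rw [tailCoeff_of_gt (k := l) (i := i.bar) hl]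
          rw [if_pos (by omega), if_pos (by omega), if_neg (by omega), if_neg (by omega)]
          ring
      · rw [tailCoeff_of_eq hi, tailCoeff_of_lt (k := l) (i := i.bar) (by rw [Idx.coe_bar]; omega)]
        rw [if_neg (by omega), if_neg (by omega), if_pos (by omega), if_neg (by omega)]
        ring
      · rw [tailCoeff_of_gt hi]
        rw [if_neg (by omega), if_neg (by omega), if_neg (by omega), if_neg (by omega)]
        ring
    rw [Finset.sum_congr rfl fun i _ => hterm i, Finset.sum_add_distrib, Finset.sum_add_distrib,
      Finset.sum_sub_distrib, Finset.sum_ite_eq' Finset.univ (lam.seq k),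
      Finset.sum_ite_eq' Finset.univ (lam.seq l).bar, if_pos (Finset.mem_univ _),
      if_pos (Finset.mem_univ _), splitCoeff_mul h hy hz, splitCoeff_mul h hy hz]
    have := pairSum_add_neg y ((lam.seq l : ℤ) - 1)
    rw [hz.total_eq_zero] at this
    unfold pairSum at this ⊢
    linear_combination -this

/-- Vectors whose leading coordinates are at different positions are linearly independent. -/
lemma linearIndependent_of_leading {ι : Type*} [LinearOrder ι] {m : ℕ} (u : Fin m → ι → ℂ)
    (lead : Fin m → ι) (hlead : StrictAnti lead) (h0 : ∀ k i, lead k < i → u k i = 0)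
    (h1 : ∀ k, u k (lead k) ≠ 0) : LinearIndependent ℂ u := by
  refine LinearIndependent.of_comp (LinearMap.funLeft ℂ ℂ lead) ?_
  have hdet : (Matrix.of fun k l => u k (lead l)).det ≠ 0 := by
    rw [Matrix.det_of_isUpperTriangular]
    · exact Finset.prod_ne_zero_iff.mpr fun k _ => h1 k
    · intro k l hkl
      exact h0 k _ (hlead hkl)
  exact Matrix.linearIndependent_rows_of_det_ne_zero hdet

/-! ### The span of the tails: membership in the intersection and uniqueness -/

section
variable {V : Type*} [AddCommGroup V] [Module ℂ V]

lemma mem_span_image_iff (e : Basis (Idx n) ℂ V) (s : Set (Idx n)) (x : V) :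
    x ∈ Submodule.span ℂ (e '' s) ↔ ∀ i, i ∉ s → e.repr x i = 0 := by
  rw [Basis.mem_span_image]
  constructor
  · intro hx i hi
    by_contra hne
    exact hi (hx (Finsupp.mem_support_iff.mpr hne))
  · intro hx i hi
    by_contra hne
    exact (Finsupp.mem_support_iff.mp hi) (hx i hne)

lemma card_le_finrank_of_linearIndependent [FiniteDimensional ℂ V] {m : ℕ} {u : Fin m → V}
    (hu : LinearIndependent ℂ u) (s : Finset (Fin m)) (W : Submodule ℂ V)
    (hW : ∀ k ∈ s, u k ∈ W) : s.card ≤ finrank ℂ W := by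
  have h1 : LinearIndependent ℂ fun k : s => (⟨u k, hW k k.2⟩ : W) := by
    refine LinearIndependent.of_comp W.subtype ?_
    exact hu.comp _ Subtype.val_injective
  simpa using h1.fintype_card_le_finrank

variable {β : LinearMap.BilinForm ℂ V} {e : Basis (Idx n) ℂ V}

/-- The vector with coordinates `tailCoeff`. -/
noncomputable def tailVec (e : Basis (Idx n) ℂ V) (lam mu : SY n) (y : Idx n → ℂ) (k : ℕ) : V :=
  e.equivFun.symm (tailCoeff lam mu y k)

lemma repr_tailVec (lam mu : SY n) (y : Idx n → ℂ) (k : ℕ) (i : Idx n) :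
    e.repr (tailVec e lam mu y k) i = tailCoeff lam mu y k i := by
  rw [tailVec, ← e.equivFun_apply, LinearEquiv.apply_symm_apply]

lemma tailVec_zero {lam mu : SY n} (h : IsSkewRow lam mu) {v : V}
    (hz : GapEquations lam mu (e.repr v)) : tailVec e lam mu (e.repr v) 0 = v := by
  rw [tailVec, tailCoeff_zero h hz]
  exact e.equivFun.symm_apply_apply v

lemma linearIndependent_tailVec {lam mu : SY n} {y : Idx n → ℂ} (hy : IsGeneric lam mu y) :
    LinearIndependent ℂ fun k : Fin n => tailVec e lam mu y k := by
  have : LinearIndependent ℂ fun k : Fin n => tailCoeff lam mu y k := by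
    refine linearIndependent_of_leading _ lam.seq lam.strictAnti
      (fun k i hi => tailCoeff_of_gt hi) fun k => ?_
    rw [tailCoeff_of_eq rfl]
    exact hy.splitCoeff_ne_zero k
  exact this.map' e.equivFun.symm.toLinearMap e.equivFun.symm.ker

/-- The next tail lives at or below `λ_{k+1} < λ_k`, so subtracting it does not disturb the leading
coefficient. -/
lemma linearIndependent_tailVec_sub {lam mu : SY n} {y : Idx n → ℂ} (hy : IsGeneric lam mu y) :
    LinearIndependent ℂ fun k : Fin n => tailVec e lam mu y k - tailVec e lam mu y (k + 1) := by
  have : LinearIndependent ℂ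
      fun k : Fin n => tailCoeff lam mu y k - tailCoeff lam mu y (k + 1) := by
    have hsucc : ∀ (k : Fin n) (i : Idx n), lam.seq k ≤ i →
        tailCoeff lam mu y ((k : ℕ) + 1) i = 0 := by
      intro k i hi
      by_cases hk : (k : ℕ) + 1 < n
      · have := lam.strictAnti (a := k) (b := ⟨k + 1, hk⟩) (Fin.lt_def.mpr (by simp))
        exact tailCoeff_of_gt (k := ⟨k + 1, hk⟩) (this.trans_le hi)
      · exact tailCoeff_of_le (by omega) i
    refine linearIndependent_of_leading _ lam.seq lam.strictAnti (fun k i hi => ?_) fun k => ?_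
    · rw [Pi.sub_apply, tailCoeff_of_gt hi, hsucc k i hi.le, sub_zero]
    · rw [Pi.sub_apply, tailCoeff_of_eq rfl, hsucc k _ le_rfl, sub_zero]
      exact hy.splitCoeff_ne_zero k
  have h2 := this.map' e.equivFun.symm.toLinearMap e.equivFun.symm.ker
  have heq : (fun k : Fin n => tailVec e lam mu y k - tailVec e lam mu y (k + 1))
      = e.equivFun.symm.toLinearMap ∘
        fun k : Fin n => tailCoeff lam mu y k - tailCoeff lam mu y (k + 1) :=
    funext fun k => (map_sub e.equivFun.symm _ _).symm
  rw [heq]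
  exact h2

/-- The span of the vectors `tailVec`. -/
noncomputable def tailSpan (e : Basis (Idx n) ℂ V) (lam mu : SY n) (y : Idx n → ℂ) :
    Submodule ℂ V :=
  Submodule.span ℂ (Set.range fun k : Fin n => tailVec e lam mu y k)

lemma tailVec_mem_tailSpan (lam mu : SY n) (y : Idx n → ℂ) (k : ℕ) :
    tailVec e lam mu y k ∈ tailSpan e lam mu y := by
  by_cases hk : k < n
  · exact Submodule.subset_span ⟨⟨k, hk⟩, rfl⟩
  · have : tailCoeff lam mu y k = 0 := funext fun i => tailCoeff_of_le (by omega) i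
    rw [tailVec, this, map_zero]
    exact zero_mem _

lemma finrank_tailSpan {lam mu : SY n} {y : Idx n → ℂ} (hy : IsGeneric lam mu y) :
    finrank ℂ (tailSpan e lam mu y) = n := by
  rw [tailSpan, finrank_span_eq_card (linearIndependent_tailVec hy), Fintype.card_fin]

lemma tailSpan_mem_isoGrass (he : IsStandardBasis β e) {lam mu : SY n} (h : IsSkewRow lam mu)
    {y : Idx n → ℂ} (hy : IsGeneric lam mu y) (hz : GapEquations lam mu y) :
    tailSpan e lam mu y ∈ isoGrass n β := by
  refine ⟨finrank_tailSpan hy, fun x hx x' hx' => ?_⟩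
  induction hx, hx' using Submodule.span_induction₂ with
  | mem_mem x x' hx hx' =>
    obtain ⟨k, rfl⟩ := hx
    obtain ⟨l, rfl⟩ := hx'
    rw [he.apply_eq_sum]
    simp only [repr_tailVec]
    exact sum_tailCoeff_mul h hy hz k l
  | zero_left => simp
  | zero_right => simp
  | add_left _ _ _ _ _ _ h1 h2 => simp [h1, h2]
  | add_right _ _ _ _ _ _ h1 h2 => simp [h1, h2]
  | smul_left _ _ _ _ _ h1 => simp [h1]
  | smul_right _ _ _ _ _ h1 => simp [h1]

/-- The `n - j` tails with index `k ≥ j` (counted from 0) are supported at or below `λ_j`. -/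
lemma tailSpan_mem_schubertOpp (he : IsStandardBasis β e) {lam mu : SY n}
    (h : IsSkewRow lam mu) {y : Idx n → ℂ} (hy : IsGeneric lam mu y)
    (hz : GapEquations lam mu y) : tailSpan e lam mu y ∈ schubertOpp β e lam := by
  have : FiniteDimensional ℂ V := Module.Finite.of_basis e
  refine ⟨tailSpan_mem_isoGrass he h hy hz, fun j => ?_⟩
  have := card_le_finrank_of_linearIndependent (linearIndependent_tailVec (e := e) hy)
    (Finset.Ici j) (tailSpan e lam mu y ⊓ Submodule.span ℂ (e '' {i | i ≤ lam.seq j}))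
    fun k hk => by
      refine ⟨tailVec_mem_tailSpan lam mu y k, ?_⟩
      rw [SetLike.mem_coe, mem_span_image_iff]
      intro i hi
      rw [repr_tailVec]
      have h1 : lam.seq k ≤ lam.seq j := lam.strictAnti.antitone (Finset.mem_Ici.mp hk)
      exact tailCoeff_of_gt (lt_of_le_of_lt h1 (not_le.mp hi))
  rw [Fin.card_Ici] at this
  omega

/-- The differences of consecutive tails with index `k ≤ j` are supported at or above `μ_k ≥ μ_j`;
there are `j + 1` of them. -/
lemma tailSpan_mem_schubert (he : IsStandardBasis β e) {lam mu : SY n}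
    (h : IsSkewRow lam mu) {y : Idx n → ℂ} (hy : IsGeneric lam mu y)
    (hz : GapEquations lam mu y) : tailSpan e lam mu y ∈ schubert β e mu := by
  have : FiniteDimensional ℂ V := Module.Finite.of_basis e
  refine ⟨tailSpan_mem_isoGrass he h hy hz, fun j => ?_⟩
  have := card_le_finrank_of_linearIndependent (linearIndependent_tailVec_sub (e := e) hy)
    (Finset.Iic j) (tailSpan e lam mu y ⊓ Submodule.span ℂ (e '' {i | mu.seq j ≤ i}))
    fun k hk => by
      refine ⟨sub_mem (tailVec_mem_tailSpan lam mu y k) (tailVec_mem_tailSpan lam mu y _), ?_⟩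
      rw [SetLike.mem_coe, mem_span_image_iff]
      intro i hi
      have h1 : mu.seq j ≤ mu.seq k := mu.strictAnti.antitone (Finset.mem_Iic.mp hk)
      have h2 : (i : ℤ) < mu.seq k := lt_of_lt_of_le (not_le.mp hi) h1
      rw [map_sub, Finsupp.sub_apply, repr_tailVec, repr_tailVec, tailCoeff_succ_eq h hz k h2]
      have h3 : (mu.seq k : ℤ) ≤ lam.seq k := h.1 k
      rw [tailCoeff_of_lt (h2.trans_le h3), sub_self]
  rw [Fin.card_Iic] at this
  omega

/-- A vector that agrees with `v` below the index `t` and vanishes above `t`, paired with `v`. -/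
lemma apply_of_truncation (he : IsStandardBasis β e) {v x : V} {t : Idx n} {c : ℂ}
    (h0 : ∀ i, t < i → e.repr x i = 0) (h1 : ∀ i, i < t → e.repr x i = c * e.repr v i) :
    β x v = c * pairSum (e.repr v) ((t : ℤ) - 1) + e.repr x t * e.repr v t.bar := by
  rw [he.apply_eq_sum, pairSum, Finset.mul_sum]
  have : e.repr x t * e.repr v t.bar
      = ∑ i, if i = t then e.repr x i * e.repr v i.bar else 0 := by simp
  rw [this, ← Finset.sum_add_distrib]
  refine Finset.sum_congr rfl fun i _ => ?_
  rcases lt_trichotomy i t with hi | hi | hi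
  · have hi' : (i : ℤ) < t := hi
    rw [h1 i hi, if_pos (by omega), if_neg hi.ne]
    ring
  · subst hi
    rw [if_neg (by omega), if_pos rfl]
    ring
  · have hi' : (t : ℤ) < i := hi
    rw [h0 i hi, if_neg (by omega), if_neg hi.ne']
    ring

/-- The Schubert conditions for `λ_k` and `μ_{k-1}` split `H` as `A ⊕ B`, and the `A`-component of
`v` is the tail. -/
lemma tailVec_mem (he : IsStandardBasis β e) {lam mu : SY n} (h : IsSkewRow lam mu) {v : V}
    (hy : IsGeneric lam mu (e.repr v)) (hz : GapEquations lam mu (e.repr v)) {H : Submodule ℂ V}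
    (hH : H ∈ isoGrass n β) (hmu : H ∈ schubert β e mu) (hlam : H ∈ schubertOpp β e lam)
    (hv : v ∈ H) (k : Fin n) : tailVec e lam mu (e.repr v) k ∈ H := by
  have : FiniteDimensional ℂ V := Module.Finite.of_basis e
  obtain ⟨_ | k, hk⟩ := k
  · rw [tailVec_zero h hz]; exact hv
  set k' : Fin n := ⟨k + 1, hk⟩
  set j : Fin n := ⟨k, by omega⟩
  have hjk : j < k' := Fin.lt_def.mpr (by simp [j, k'])
  have hle : (lam.seq k' : ℤ) ≤ mu.seq j := seq_le_seq_of_lt h hjk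
  set A := H ⊓ Submodule.span ℂ (e '' {i | i ≤ lam.seq k'}) with hA
  set B := H ⊓ Submodule.span ℂ (e '' {i | mu.seq j ≤ i}) with hB
  have hAm : ∀ x ∈ A, ∀ i, lam.seq k' < i → e.repr x i = 0 := fun x hx i hi =>
    (mem_span_image_iff e _ x).mp hx.2 i (not_le.mpr hi)
  have hBm : ∀ x ∈ B, ∀ i, i < mu.seq j → e.repr x i = 0 := fun x hx i hi =>
    (mem_span_image_iff e _ x).mp hx.2 i (not_le.mpr hi)
  have hshared : Shared lam mu k' ↔ (mu.seq j : ℤ) = lam.seq k' := by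
    constructor
    · rintro ⟨m, hm, hm'⟩
      obtain rfl : j = m := Fin.ext (by simpa [k', j] using hm)
      exact hm'
    · intro hm
      exact ⟨j, rfl, hm⟩
  have hinf : A ⊓ B = ⊥ := by
    rw [eq_bot_iff]
    rintro x ⟨hxA, hxB⟩
    have hoff : ∀ i, i ≠ lam.seq k' → e.repr x i = 0 := by
      intro i hi
      rcases lt_or_gt_of_ne hi with hi | hi
      · exact hBm x hxB i (hi.trans_le hle)
      · exact hAm x hxA i hi
    have hon : e.repr x (lam.seq k') = 0 := by
      -- At a shared endpoint both supports allow the coordinate `λ_k`. Orthogonality to `v` makes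
      -- its product with the nonzero coordinate of `v` at `-λ_k` vanish.
      by_cases hs : Shared lam mu k'
      · have hβ := apply_of_truncation he (v := v) (x := x) (t := lam.seq k') (c := 0)
          (fun i hi => hoff i hi.ne') (fun i hi => by rw [hoff i hi.ne, zero_mul])
        rw [hH.2 x hxA.1 v hv, zero_mul, zero_add] at hβ
        exact (mul_eq_zero.mp hβ.symm).resolve_right (hy.bar_ne_zero k' hs)
      · exact hBm x hxB _ (lt_of_not_shared h hs hjk)
    rw [Submodule.mem_bot]
    refine e.ext_elem fun i => ?_
    rw [map_zero, Finsupp.zero_apply]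
    by_cases hi : i = lam.seq k'
    · rw [hi, hon]
    · exact hoff i hi
  have hsup : A ⊔ B = H := by
    -- The two Schubert bounds, `n - k - 1` and `k + 1`, add up to `n`.
    refine Submodule.eq_of_le_of_finrank_le (sup_le inf_le_left inf_le_left) ?_
    have h1 := Submodule.finrank_sup_add_finrank_inf_eq A B
    rw [hinf, finrank_bot] at h1
    have h2 : n + 1 - (k + 1 + 1) ≤ finrank ℂ A := hlam.2 k'
    have h3 : k + 1 ≤ finrank ℂ B := hmu.2 j
    rw [hH.1]
    omega
  rw [← hsup] at hv
  obtain ⟨a, ha, b, hb, hab⟩ := Submodule.mem_sup.mp hv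
  rw [hsup] at hv
  have hcoord : ∀ i, e.repr v i = e.repr a i + e.repr b i := fun i => by
    rw [← hab, map_add, Finsupp.add_apply]
  have hlow : ∀ i, i < mu.seq j → e.repr a i = e.repr v i := fun i hi => by
    rw [hcoord, hBm b hb i hi, add_zero]
  have hae : a = tailVec e lam mu (e.repr v) k' := by
    refine e.ext_elem fun i => ?_
    rw [repr_tailVec]
    rcases lt_trichotomy i (lam.seq k') with hi | hi | hi
    · rw [tailCoeff_of_lt hi, hlow i (hi.trans_le hle)]
    · rw [tailCoeff_of_eq (congrArg Subtype.val hi), hi, splitCoeff]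
      split_ifs with hs
      -- The equation `β(a, v) = 0` is linear in the one undetermined coordinate of `a`; solving it
      -- gives `splitCoeff`.
      · have hβ := apply_of_truncation he (v := v) (x := a) (t := lam.seq k') (c := 1)
          (hAm a ha) (fun i hi => by rw [hlow i (hi.trans_le hle), one_mul])
        rw [hH.2 a ha.1 v hv] at hβ
        rw [eq_div_iff (hy.bar_ne_zero k' hs)]
        linear_combination -hβ
      · exact hlow _ (lt_of_not_shared h hs hjk)
    · rw [tailCoeff_of_gt hi, hAm a ha i hi]
  rw [← hae]
  exact ha.1

/-- A generic vector of `Z_{λ/μ}` lies on exactly one member of the intersection. -/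
theorem inter_eq_singleton (he : IsStandardBasis β e) {lam mu : SY n} (h : IsSkewRow lam mu)
    {v : V} (hv : v ≠ 0) (hy : IsGeneric lam mu (e.repr v))
    (hz : GapEquations lam mu (e.repr v)) :
    schubert β e mu ∩ schubertOpp β e lam ∩ specialSchubert n β (ℂ ∙ v)
      = {tailSpan e lam mu (e.repr v)} := by
  have : FiniteDimensional ℂ V := Module.Finite.of_basis e
  refine Set.Subset.antisymm ?_ ?_
  · rintro H ⟨⟨hmu, hlam⟩, hH, hne⟩
    have hvH : v ∈ H := by
      obtain ⟨x, ⟨hxH, hxv⟩, hx0⟩ := Submodule.exists_mem_ne_zero_of_ne_bot hne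
      obtain ⟨c, rfl⟩ := Submodule.mem_span_singleton.mp hxv
      have hc : c ≠ 0 := fun hc => hx0 (by rw [hc, zero_smul])
      exact (Submodule.smul_mem_iff _ hc).mp hxH
    have hle : tailSpan e lam mu (e.repr v) ≤ H := by
      refine Submodule.span_le.mpr ?_
      rintro _ ⟨k, rfl⟩
      exact tailVec_mem he h hy hz hH hmu hlam hvH k
    exact (Submodule.eq_of_le_of_finrank_le hle (by rw [hH.1, finrank_tailSpan hy])).symm
  · rintro _ rfl
    have hvH := tailVec_mem_tailSpan (e := e) lam mu (e.repr v) 0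
    rw [tailVec_zero h hz] at hvH
    refine ⟨⟨tailSpan_mem_schubert he h hy hz, tailSpan_mem_schubertOpp he h hy hz⟩,
      tailSpan_mem_isoGrass he h hy hz, fun hbot => hv ?_⟩
    have : v ∈ tailSpan e lam mu (e.repr v) ⊓ (ℂ ∙ v) :=
      ⟨hvH, Submodule.mem_span_singleton_self v⟩
    rwa [hbot, Submodule.mem_bot] at this

end

/-! ### Density of the generic vectors -/

/-- The index `i` is next to a crossed gap. -/
def NextToCrossed (lam mu : SY n) (i : ℤ) : Prop :=
  Crosses lam mu i ∨ Crosses lam mu (i - 1)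

lemma nextToCrossed_neg_iff {lam mu : SY n} (h : IsSkewRow lam mu) (i : ℤ) :
    NextToCrossed lam mu (-i) ↔ NextToCrossed lam mu i := by
  have h1 := crosses_neg_iff h i
  have h2 := crosses_neg_iff h (i - 1)
  rw [show -(i - 1) - 1 = -i by ring] at h2
  rw [NextToCrossed, NextToCrossed, h1, h2, or_comm]

lemma not_nextToCrossed_of_eq {lam mu : SY n} {j : Fin n} (hj : lam.seq j = mu.seq j) :
    ¬ NextToCrossed lam mu (lam.seq j) := by
  have hj' : (lam.seq j : ℤ) = mu.seq j := by rw [hj]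
  rintro (⟨m, h1, h2⟩ | ⟨m, h1, h2⟩)
  · have hm : m < j := lam.strictAnti.lt_iff_gt.mp h2
    have := mu.seq_lt_seq hm
    omega
  · have hm : j < m := mu.strictAnti.lt_iff_gt.mp (show (mu.seq m : ℤ) < mu.seq j by omega)
    have := lam.seq_lt_seq hm
    omega

lemma NextToCrossed.ne_bar {lam mu : SY n} (h : IsSkewRow lam mu) {i : Idx n}
    (hi : NextToCrossed lam mu i) {j : Fin n} (hj : lam.seq j = mu.seq j) :
    (lam.seq j).bar ≠ i := by
  rintro rfl
  rw [Idx.coe_bar, nextToCrossed_neg_iff h] at hi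
  exact not_nextToCrossed_of_eq hj hi

/-- The vectors of `Z_{λ/μ}` at which `f` does not vanish are Zariski dense in `Z_{λ/μ}`. -/
def DenseNonvanishing (lam mu : SY n) (f : MvPolynomial (Idx n) ℂ) : Prop :=
  ∀ p : MvPolynomial (Idx n) ℂ,
    (∀ y, GapEquations lam mu y → MvPolynomial.eval y f ≠ 0 → MvPolynomial.eval y p = 0) →
    ∀ y, GapEquations lam mu y → MvPolynomial.eval y p = 0

lemma DenseNonvanishing.one (lam mu : SY n) : DenseNonvanishing lam mu 1 :=
  fun _ hp y hy => hp y hy (by simp)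

/-- If `p` vanishes where `f * g ≠ 0`, then `p * f` vanishes where `g ≠ 0`, hence everywhere on the
locus, so `p` vanishes where `f ≠ 0`. -/
lemma DenseNonvanishing.mul {lam mu : SY n} {f g : MvPolynomial (Idx n) ℂ}
    (hf : DenseNonvanishing lam mu f) (hg : DenseNonvanishing lam mu g) :
    DenseNonvanishing lam mu (f * g) := by
  intro p hp
  refine hf p fun y hy hfy => ?_
  have := hg (p * f) (fun y hy hgy => ?_) y hy
  · rw [map_mul] at this
    exact (mul_eq_zero.mp this).resolve_right hfy
  · rw [map_mul]
    by_cases hfy : MvPolynomial.eval y f = 0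
    · rw [hfy, mul_zero]
    · rw [hp y hy (by rw [map_mul]; exact mul_ne_zero hfy hgy), zero_mul]

lemma DenseNonvanishing.prod {lam mu : SY n} {ι : Type*} (s : Finset ι)
    (f : ι → MvPolynomial (Idx n) ℂ) (hf : ∀ i ∈ s, DenseNonvanishing lam mu (f i)) :
    DenseNonvanishing lam mu (∏ i ∈ s, f i) :=
  Finset.prod_induction f _ (fun _ _ => DenseNonvanishing.mul) (DenseNonvanishing.one lam mu) hf

/-- Density can be tested on polynomial curves through the points of a dense open subset. -/
lemma DenseNonvanishing.of_curve {lam mu : SY n} {f g : MvPolynomial (Idx n) ℂ}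
    (hg : DenseNonvanishing lam mu g)
    (hcurve : ∀ z, GapEquations lam mu z → MvPolynomial.eval z g ≠ 0 →
      ∃ γ : Idx n → Polynomial ℂ, (∀ i, (γ i).eval 0 = z i) ∧
        (∀ s, GapEquations lam mu fun i => (γ i).eval s) ∧
        ∃ s, MvPolynomial.eval (fun i => (γ i).eval s) f ≠ 0) :
    DenseNonvanishing lam mu f := by
  intro p hp
  refine hg p fun z hz hgz => ?_
  obtain ⟨γ, h0, hγ, s₀, hs₀⟩ := hcurve z hz hgz
  have heval : ∀ (q : MvPolynomial (Idx n) ℂ) (s : ℂ),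
      (MvPolynomial.aeval γ q).eval s = MvPolynomial.eval (fun i => (γ i).eval s) q := by
    intro q s
    rw [← Polynomial.coe_aeval_eq_eval, ← AlgHom.comp_apply, MvPolynomial.comp_aeval,
      ← MvPolynomial.coe_aeval_eq_eval]
    rfl
  have hf0 : MvPolynomial.aeval γ f ≠ 0 := fun hf => hs₀ (by rw [← heval, hf]; simp)
  -- Along the curve the product vanishes at every parameter, so it is the zero polynomial, and
  -- `ℂ[s]` is a domain.
  have hmul : MvPolynomial.aeval γ p * MvPolynomial.aeval γ f = 0 := by
    refine Polynomial.funext fun s => ?_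
    rw [Polynomial.eval_mul, heval, heval, Polynomial.eval_zero]
    by_cases hfs : MvPolynomial.eval (fun i => (γ i).eval s) f = 0
    · rw [hfs, mul_zero]
    · rw [hp _ (hγ s) hfs, zero_mul]
  have hp0 := (mul_eq_zero.mp hmul).resolve_right hf0
  have := heval p 0
  rw [hp0, Polynomial.eval_zero] at this
  rw [this]
  simp only [h0]

/-- With the coordinate at `-t` zero, changing the coordinate `t` alters no product `z_i z_{-i}`. -/
lemma GapEquations.add_single {lam mu : SY n} {z : Idx n → ℂ}
    (hz : GapEquations lam mu z) {t : Idx n} (h0 : (t : ℤ) ≠ 0) (hbar : z t.bar = 0)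
    (ht : ∀ j, lam.seq j = mu.seq j → (lam.seq j).bar ≠ t) (s : ℂ) :
    GapEquations lam mu fun i => z i + if i = t then s else 0 := by
  refine ⟨fun j hj => ?_, fun hc => ?_, fun g hg => ?_⟩
  · simp only [if_neg (ht j hj), add_zero]
    exact hz.bar_eq_zero j hj
  · have : Idx.zero n ≠ t := fun e => h0 (by rw [← e]; rfl)
    simp only [if_neg this, add_zero]
    exact hz.zero_eq_zero hc
  · refine Eq.trans ?_ (hz.pairSum_eq_zero g hg)
    refine Finset.sum_congr rfl fun i _ => ?_
    refine congrArg (fun c => if (i : ℤ) ≤ g then c else 0) ?_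
    have hne : t.bar ≠ t := fun e => h0 (by
      have := congrArg Subtype.val e
      simp only [Idx.coe_bar] at this
      omega)
    dsimp only
    by_cases hi : i = t
    · subst hi
      rw [if_neg hne, hbar, add_zero, mul_zero, mul_zero]
    · by_cases hi' : i.bar = t
      · have : i = t.bar := by rw [← hi', Idx.bar_bar]
        subst this
        rw [hbar, if_neg hne, add_zero, zero_mul, zero_mul]
      · rw [if_neg hi, if_neg hi', add_zero, add_zero]

/-! ### Polynomial curves inside the zero locus -/

/-- The increment of the product of the coordinates `b` and `-b` along the curve `moved`, halved
when `b = 0`. -/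
noncomputable def increment (z : Idx n → ℂ) (b : Idx n) (s : ℂ) : ℂ :=
  (if (b : ℤ) = 0 then 1 / 2 else 1) * (s * (z b + z b.bar + s))

/-- A curve of vectors on which the increment of the product of the coordinates `b` and `-b` is
compensated by the coordinate `t`. -/
noncomputable def moved (z : Idx n → ℂ) (t b : Idx n) (s : ℂ) (i : Idx n) : ℂ :=
  z i + (if (i : ℤ) = b ∨ (i : ℤ) = -b then s else 0)
    - if i = t then increment z b s / z t.bar else 0

lemma moved_of_eq {z : Idx n → ℂ} {t b i : Idx n} {s : ℂ} (hi : (i : ℤ) ≠ t)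
    (hb : (i : ℤ) = b ∨ (i : ℤ) = -b) : moved z t b s i = z i + s := by
  rw [moved, if_pos hb, if_neg fun e => hi (congrArg Subtype.val e), sub_zero]

lemma moved_of_ne {z : Idx n → ℂ} {t b i : Idx n} {s : ℂ} (hi : (i : ℤ) ≠ t)
    (hb : (i : ℤ) ≠ b) (hb' : (i : ℤ) ≠ -b) : moved z t b s i = z i := by
  rw [moved, if_neg (not_or.mpr ⟨hb, hb'⟩), if_neg fun e => hi (congrArg Subtype.val e),
    sub_zero, add_zero]

lemma moved_self {z : Idx n → ℂ} {t b : Idx n} {s : ℂ} (hb : (t : ℤ) ≠ b)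
    (hb' : (t : ℤ) ≠ -b) : moved z t b s t = z t - increment z b s / z t.bar := by
  rw [moved, if_neg (not_or.mpr ⟨hb, hb'⟩), if_pos rfl, add_zero]

/-- The coordinate at `-t` stays fixed, so the product at `±t` drops by exactly the increment. For
`b = 0` both indicators of `b` and `-b` fire at one index, which the factor one half compensates. -/
lemma moved_mul {z : Idx n → ℂ} {t b : Idx n} (h0 : (t : ℤ) ≠ 0) (hbar : z t.bar ≠ 0)
    (htb : (t : ℤ) ≠ b) (htb' : (t : ℤ) ≠ -b) (s : ℂ) (i : Idx n) :
    moved z t b s i * moved z t b s i.bar = z i * z i.bar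
      + ((if i = b then increment z b s else 0) + (if i = b.bar then increment z b s else 0)
      - (if i = t then increment z b s else 0) - (if i = t.bar then increment z b s else 0)) := by
  have e : ∀ a c : Idx n, a = c ↔ (a : ℤ) = c := fun a c => Subtype.ext_iff
  have hib := Idx.coe_bar i
  have hbb := Idx.coe_bar b
  have htt := Idx.coe_bar t
  simp only [e]
  by_cases h1 : (i : ℤ) = t
  · rw [if_neg (by omega), if_neg (by omega), if_pos h1, if_neg (by omega)]
    obtain rfl : i = t := Subtype.ext h1
    rw [moved_self htb htb', moved_of_ne (by omega) (by omega) (by omega)]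
    field_simp
    ring
  by_cases h2 : (i : ℤ) = t.bar
  · rw [if_neg (by omega), if_neg (by omega), if_neg h1, if_pos h2]
    obtain rfl : i = t.bar := Subtype.ext h2
    rw [Idx.bar_bar, moved_self htb htb', moved_of_ne (by omega) (by omega) (by omega)]
    field_simp
    ring
  by_cases h3 : (i : ℤ) = b ∨ (i : ℤ) = b.bar
  · rw [moved_of_eq h1 (by omega), moved_of_eq (i := i.bar) (by omega) (by omega), if_neg h1,
      if_neg h2, increment]
    have hsum : z i + z i.bar = z b + z b.bar := by
      rcases h3 with h3 | h3
      · obtain rfl : i = b := Subtype.ext h3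
        rfl
      · obtain rfl : i = b.bar := Subtype.ext h3
        rw [Idx.bar_bar, add_comm]
    rw [← hsum]
    by_cases h4 : (b : ℤ) = 0
    · rw [if_pos h4, if_pos (show (i : ℤ) = b by omega),
        if_pos (show (i : ℤ) = b.bar by omega)]
      ring
    · rw [if_neg h4]
      rcases h3 with h3 | h3
      · rw [if_pos h3, if_neg (by omega)]
        ring
      · rw [if_neg (by omega), if_pos h3]
        ring
  · rw [moved_of_ne h1 (by omega) (by omega), moved_of_ne (i := i.bar) (by omega) (by omega)
      (by omega), if_neg (by omega), if_neg (by omega), if_neg h1, if_neg h2]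
    ring

lemma sum_ite_le_ite (g : ℤ) (a : Idx n) (c : ℂ) :
    (∑ i : Idx n, if (i : ℤ) ≤ g then (if i = a then c else 0) else 0)
      = if (a : ℤ) ≤ g then c else 0 := by
  rw [Finset.sum_eq_single a]
  · simp
  · intro i _ hi
    rw [if_neg hi, ite_self]
  · simp

lemma pairSum_moved {z : Idx n → ℂ} {t b : Idx n} (h0 : (t : ℤ) ≠ 0) (hbar : z t.bar ≠ 0)
    (htb : (t : ℤ) ≠ b) (htb' : (t : ℤ) ≠ -b) (s : ℂ) (g : ℤ) :
    pairSum (moved z t b s) g = pairSum z g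
      + ((if (b : ℤ) ≤ g then increment z b s else 0)
      + (if -(b : ℤ) ≤ g then increment z b s else 0)
      - (if (t : ℤ) ≤ g then increment z b s else 0)
      - (if -(t : ℤ) ≤ g then increment z b s else 0)) := by
  rw [← Idx.coe_bar b, ← Idx.coe_bar t, ← sum_ite_le_ite, ← sum_ite_le_ite, ← sum_ite_le_ite,
    ← sum_ite_le_ite, pairSum, pairSum, ← Finset.sum_add_distrib, ← Finset.sum_sub_distrib,
    ← Finset.sum_sub_distrib, ← Finset.sum_add_distrib]
  refine Finset.sum_congr rfl fun i _ => ?_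
  rw [moved_mul h0 hbar htb htb']
  by_cases hi : (i : ℤ) ≤ g
  · simp only [if_pos hi]
  · simp only [if_neg hi]
    ring

/-- Two indices separated only by a crossed gap. -/
def Neighbours (lam mu : SY n) (t b : ℤ) : Prop :=
  (b = t - 1 ∧ Crosses lam mu (t - 1)) ∨ (b = t + 1 ∧ Crosses lam mu t)

lemma NextToCrossed.exists_neighbours {lam mu : SY n} {t : Idx n}
    (ht : NextToCrossed lam mu t) : ∃ b : Idx n, Neighbours lam mu t b := by
  obtain ⟨ht1, ht2⟩ := t.2
  rcases ht with hc | hc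
  · obtain ⟨j, h1, h2⟩ := id hc
    have := (lam.seq j).2.2
    exact ⟨⟨(t : ℤ) + 1, by omega, by omega⟩, Or.inr ⟨rfl, hc⟩⟩
  · obtain ⟨j, h1, h2⟩ := id hc
    have := (mu.seq j).2.1
    exact ⟨⟨(t : ℤ) - 1, by omega, by omega⟩, Or.inl ⟨rfl, hc⟩⟩

/-- Shifting a product from `±t` to `±b` changes partial sums only at the gap between `t` and `b`
and at its mirror image, both crossed; the linear forms involve neither `±t` nor `±b`. -/
lemma GapEquations.moved {lam mu : SY n} (h : IsSkewRow lam mu) {z : Idx n → ℂ}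
    (hz : GapEquations lam mu z) {t b : Idx n} (h0 : (t : ℤ) ≠ 0) (hbar : z t.bar ≠ 0)
    (htb : Neighbours lam mu t b) (s : ℂ) : GapEquations lam mu (moved z t b s) := by
  have hb : NextToCrossed lam mu b := by
    rcases htb with ⟨hb, hc⟩ | ⟨hb, hc⟩
    · exact Or.inl (by rwa [hb])
    · exact Or.inr (by rwa [hb, add_sub_cancel_right])
  have ht : NextToCrossed lam mu t := htb.elim (fun hc => Or.inr hc.2) fun hc => Or.inl hc.2
  have hb' : NextToCrossed lam mu b.bar := by rwa [Idx.coe_bar, nextToCrossed_neg_iff h]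
  refine ⟨fun j hj => ?_, fun hc => ?_, fun g hg => ?_⟩
  · have h1 := hb.ne_bar h hj
    have h2 := hb'.ne_bar h hj
    have h3 := ht.ne_bar h hj
    rw [IsotropicPieri.moved, if_neg, if_neg h3, hz.bar_eq_zero j hj]
    · ring
    · rintro (e | e)
      · exact h1 (Subtype.ext e)
      · exact h2 (Subtype.ext e)
  · have hc' : ¬ NextToCrossed lam mu 0 := by
      have := crosses_neg_iff h 0
      rintro (h1 | h1)
      · exact hc h1
      · exact hc (this.mp (by simpa using h1))
    have hb0 : (b : ℤ) ≠ 0 := fun e => hc' (by rwa [← e])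
    rw [IsotropicPieri.moved, if_neg, if_neg, hz.zero_eq_zero hc]
    · ring
    · rintro rfl
      exact h0 rfl
    · rw [Idx.coe_zero]
      omega
  · have hg' : ¬ Crosses lam mu (-g - 1) := by rwa [crosses_neg_iff h]
    have hne : ∀ m, Crosses lam mu m → g ≠ m ∧ -g - 1 ≠ m := fun m hm =>
      ⟨fun e => hg (e ▸ hm), fun e => hg' (e ▸ hm)⟩
    have key : ((b : ℤ) ≤ g ↔ (t : ℤ) ≤ g) ∧ (-(b : ℤ) ≤ g ↔ -(t : ℤ) ≤ g) := by
      rcases htb with ⟨hb, hc⟩ | ⟨hb, hc⟩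
      · have := hne _ hc
        omega
      · have := hne _ hc
        omega
    have hn1 : (t : ℤ) ≠ b ∧ (t : ℤ) ≠ -b := by
      rcases htb with ⟨hb, -⟩ | ⟨hb, -⟩ <;> omega
    rw [pairSum_moved h0 hbar hn1.1 hn1.2, hz.pairSum_eq_zero g hg]
    simp only [key.1, key.2]
    ring

lemma exists_increment_ne_zero (z : Idx n → ℂ) (b : Idx n) : ∃ s, increment z b s ≠ 0 := by
  unfold increment
  have hc : (if (b : ℤ) = 0 then 1 / 2 else 1 : ℂ) ≠ 0 := by split_ifs <;> norm_num
  by_cases h1 : z b + z b.bar + 1 = 0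
  · refine ⟨2, mul_ne_zero hc (mul_ne_zero two_ne_zero ?_)⟩
    rw [show z b + z b.bar + 2 = 1 by linear_combination h1]
    exact one_ne_zero
  · exact ⟨1, mul_ne_zero hc (mul_ne_zero one_ne_zero h1)⟩

lemma exists_polynomial_moved (z : Idx n → ℂ) (t b : Idx n) :
    ∃ γ : Idx n → Polynomial ℂ, ∀ s, (fun i => (γ i).eval s) = moved z t b s := by
  refine ⟨fun i => Polynomial.C (z i)
    + (if (i : ℤ) = b ∨ (i : ℤ) = -b then Polynomial.X else 0)
    - if i = t then Polynomial.C ((if (b : ℤ) = 0 then 1 / 2 else 1) / z t.bar)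
      * (Polynomial.X * (Polynomial.C (z b + z b.bar) + Polynomial.X)) else 0, fun s => ?_⟩
  funext i
  unfold moved increment
  simp only [Polynomial.eval_sub, Polynomial.eval_add, Polynomial.eval_C]
  congr 1
  · congr 1
    split_ifs <;> simp
  · by_cases hi : i = t
    · rw [if_pos hi, if_pos hi]
      simp only [Polynomial.eval_mul, Polynomial.eval_add, Polynomial.eval_C, Polynomial.eval_X]
      ring
    · rw [if_neg hi, if_neg hi, Polynomial.eval_zero]

lemma moved_zero (z : Idx n → ℂ) (t b : Idx n) : moved z t b 0 = z := by
  funext i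
  simp [moved, increment]

lemma exists_curve_add_single {lam mu : SY n} {z : Idx n → ℂ}
    (hz : GapEquations lam mu z) {t : Idx n} (h0 : (t : ℤ) ≠ 0) (hbar : z t.bar = 0)
    (ht : ∀ j, lam.seq j = mu.seq j → (lam.seq j).bar ≠ t) :
    ∃ γ : Idx n → Polynomial ℂ, (∀ i, (γ i).eval 0 = z i) ∧
      (∀ s, GapEquations lam mu fun i => (γ i).eval s) ∧
      ∃ s, MvPolynomial.eval (fun i => (γ i).eval s) (MvPolynomial.X t) ≠ 0 := by
  refine ⟨fun i => Polynomial.C (z i) + if i = t then Polynomial.X else 0, fun i => ?_,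
    fun s => ?_, 1 - z t, ?_⟩
  · dsimp only
    split_ifs <;> simp
  · convert hz.add_single h0 hbar ht s using 2 with i
    by_cases hi : i = t <;> simp [hi]
  · simp

/-- The coordinate at `-λ_k` vanishes on the whole locus, which leaves the coordinate at `λ_k` free.
-/
lemma denseNonvanishing_X_of_eq {lam mu : SY n} {k : Fin n}
    (hk : lam.seq k = mu.seq k) : DenseNonvanishing lam mu (MvPolynomial.X (lam.seq k)) := by
  refine (DenseNonvanishing.one lam mu).of_curve fun z hz _ =>
    exists_curve_add_single hz (lam.seq_ne_zero k) (hz.bar_eq_zero k hk) fun j _ e => ?_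
  have := congrArg Subtype.val e
  rw [Idx.coe_bar] at this
  exact lam.seq_add_ne_zero j k (by omega)

/-- Where the coordinate at `-t` vanishes, the coordinate `t` is free; elsewhere, a nonzero
increment moves the coordinate `t` off zero. -/
lemma denseNonvanishing_X {lam mu : SY n} (h : IsSkewRow lam mu) {t : Idx n}
    (h0 : (t : ℤ) ≠ 0) (ht : NextToCrossed lam mu t) :
    DenseNonvanishing lam mu (MvPolynomial.X t) := by
  refine (DenseNonvanishing.one lam mu).of_curve fun z hz _ => ?_
  by_cases hbar : z t.bar = 0
  · exact exists_curve_add_single hz h0 hbar fun j hj => ht.ne_bar h hj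
  · obtain ⟨b, hb⟩ := ht.exists_neighbours
    obtain ⟨γ, hγ⟩ := exists_polynomial_moved z t b
    refine ⟨γ, fun i => ?_, fun s => ?_, ?_⟩
    · rw [congrFun (hγ 0) i, moved_zero]
    · rw [hγ s]
      exact hz.moved h h0 hbar hb s
    · simp only [hγ, MvPolynomial.eval_X]
      by_cases hzt : z t = 0
      · obtain ⟨s, hs⟩ := exists_increment_ne_zero z b
        refine ⟨s, ?_⟩
        have hn1 : ¬ ((t : ℤ) = b ∨ (t : ℤ) = -b) := by
          rcases hb with ⟨hb, -⟩ | ⟨hb, -⟩ <;> omega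
        rw [moved, if_neg hn1, if_pos rfl, hzt, zero_add, zero_sub]
        exact neg_ne_zero.mpr (div_ne_zero hs hbar)
      · exact ⟨0, by rwa [moved_zero]⟩

/-! ### Density for the factors of the genericity polynomial -/

/-- The polynomial `pairSum`. -/
noncomputable def pairPoly (n : ℕ) (g : ℤ) : MvPolynomial (Idx n) ℂ :=
  ∑ i : Idx n, if (i : ℤ) ≤ g then MvPolynomial.X i * MvPolynomial.X i.bar else 0

lemma eval_pairPoly (y : Idx n → ℂ) (g : ℤ) :
    MvPolynomial.eval y (pairPoly n g) = pairSum y g := by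
  rw [pairPoly, pairSum, map_sum]
  refine Finset.sum_congr rfl fun i _ => ?_
  split_ifs <;> simp

lemma isHomogeneous_pairPoly (n : ℕ) (g : ℤ) : (pairPoly n g).IsHomogeneous 2 := by
  refine MvPolynomial.IsHomogeneous.sum _ _ _ fun i _ => ?_
  split_ifs
  · exact (MvPolynomial.isHomogeneous_X ℂ i).mul (MvPolynomial.isHomogeneous_X ℂ i.bar)
  · exact MvPolynomial.isHomogeneous_zero _ _ _

/-- Moving a product from `±t` to `±(t - 1)` carries it across the crossed gap `t - 1` and so
changes this partial sum. The move needs a nonzero coordinate at `-t`, which is itself a dense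
condition. -/
lemma denseNonvanishing_pairPoly {lam mu : SY n} (h : IsSkewRow lam mu) {t : Idx n}
    (h0 : (t : ℤ) ≠ 0) (ht : Crosses lam mu ((t : ℤ) - 1)) :
    DenseNonvanishing lam mu (pairPoly n ((t : ℤ) - 1)) := by
  have htc : NextToCrossed lam mu t.bar := by
    rw [Idx.coe_bar, nextToCrossed_neg_iff h]
    exact Or.inr ht
  have hX := denseNonvanishing_X h (t := t.bar) (by rw [Idx.coe_bar]; omega) htc
  refine hX.of_curve fun z hz hbar => ?_
  rw [MvPolynomial.eval_X] at hbar
  obtain ⟨j, h1, h2⟩ := id ht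
  have hj := (mu.seq j).2.1
  have ht2 := t.2.2
  obtain ⟨b, hb⟩ : ∃ b : Idx n, (b : ℤ) = t - 1 := ⟨⟨(t : ℤ) - 1, by omega, by omega⟩, rfl⟩
  obtain ⟨γ, hγ⟩ := exists_polynomial_moved z t b
  refine ⟨γ, fun i => ?_, fun s => ?_, ?_⟩
  · rw [congrFun (hγ 0) i, moved_zero]
  · rw [hγ s]
    exact hz.moved h h0 hbar (Or.inl ⟨hb, ht⟩) s
  · simp only [hγ, eval_pairPoly]
    by_cases hzt : pairSum z ((t : ℤ) - 1) = 0
    · obtain ⟨s, hs⟩ := exists_increment_ne_zero z b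
      refine ⟨s, ?_⟩
      rw [pairSum_moved h0 hbar (by omega) (by omega), hzt]
      -- Both inequalities mean `t ≥ 1`, so the mirror contributions cancel and one increment
      -- remains.
      have hiff : -(t : ℤ) ≤ t - 1 ↔ -(b : ℤ) ≤ t - 1 := by omega
      simp only [hiff, if_pos hb.le, if_neg (show ¬ (t : ℤ) ≤ t - 1 by omega)]
      ring_nf
      exact hs
    · exact ⟨0, by rwa [moved_zero]⟩

open Classical in
/-- The polynomial whose nonvanishing expresses `IsGeneric`. -/
noncomputable def genericPoly (lam mu : SY n) : MvPolynomial (Idx n) ℂ :=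
  ∏ k : Fin n, if Shared lam mu k then
    MvPolynomial.X (lam.seq k).bar * pairPoly n ((lam.seq k : ℤ) - 1)
  else MvPolynomial.X (lam.seq k)

lemma isGeneric_of_eval_ne_zero {lam mu : SY n} {y : Idx n → ℂ}
    (hy : MvPolynomial.eval y (genericPoly lam mu) ≠ 0) : IsGeneric lam mu y := by
  rw [genericPoly, map_prod, Finset.prod_ne_zero_iff] at hy
  refine ⟨fun k hk => ?_, fun k hk => ?_, fun k hk => ?_⟩
  · have := hy k (Finset.mem_univ k)
    rwa [if_neg hk, MvPolynomial.eval_X] at this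
  · have := hy k (Finset.mem_univ k)
    rw [if_pos hk, map_mul, MvPolynomial.eval_X] at this
    exact left_ne_zero_of_mul this
  · have := hy k (Finset.mem_univ k)
    rw [if_pos hk, map_mul, eval_pairPoly] at this
    exact right_ne_zero_of_mul this

lemma exists_isHomogeneous_genericPoly (lam mu : SY n) :
    ∃ k, (genericPoly lam mu).IsHomogeneous k := by
  classical
  refine ⟨_, MvPolynomial.IsHomogeneous.prod Finset.univ _
    (fun k => if Shared lam mu k then 1 + 2 else 1) fun k _ => ?_⟩
  split_ifs
  · exact (MvPolynomial.isHomogeneous_X _ _).mul (isHomogeneous_pairPoly _ _)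
  · exact MvPolynomial.isHomogeneous_X _ _

lemma denseNonvanishing_genericPoly {lam mu : SY n} (h : IsSkewRow lam mu) :
    DenseNonvanishing lam mu (genericPoly lam mu) := by
  refine DenseNonvanishing.prod _ _ fun k _ => ?_
  have hlt : (lam.seq k ≠ mu.seq k) → Crosses lam mu ((lam.seq k : ℤ) - 1) := fun hne => by
    have h1 : (mu.seq k : ℤ) ≤ lam.seq k := h.1 k
    have h2 : (lam.seq k : ℤ) ≠ mu.seq k := fun e => hne (Subtype.ext e)
    exact ⟨k, by omega, by omega⟩
  split_ifs with hk
  · obtain ⟨j, hj, hj'⟩ := hk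
    have hc : Crosses lam mu ((lam.seq k : ℤ) - 1) := hlt fun e => by
      have hjk : j < k := Fin.lt_def.mpr (by omega)
      have := mu.seq_lt_seq hjk
      rw [hj', e] at this
      exact lt_irrefl _ this
    refine DenseNonvanishing.mul (denseNonvanishing_X h ?_ ?_)
      (denseNonvanishing_pairPoly h (lam.seq_ne_zero k) hc)
    · rw [Idx.coe_bar]
      exact neg_ne_zero.mpr (lam.seq_ne_zero k)
    · rw [Idx.coe_bar, nextToCrossed_neg_iff h]
      exact Or.inr hc
  · by_cases he : lam.seq k = mu.seq k
    · exact denseNonvanishing_X_of_eq he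
    · exact denseNonvanishing_X h (lam.seq_ne_zero k) (Or.inr (hlt he))

/-! ### General lines -/

lemma eval_smul_of_isHomogeneous {σ : Type*} {p : MvPolynomial σ ℂ} {k : ℕ}
    (hp : p.IsHomogeneous k) (c : ℂ) (y : σ → ℂ) :
    MvPolynomial.eval (fun i => c * y i) p = c ^ k * MvPolynomial.eval y p := by
  rw [MvPolynomial.eval_eq, MvPolynomial.eval_eq, Finset.mul_sum]
  refine Finset.sum_congr rfl fun d hd => ?_
  have hdeg : ∑ i ∈ d.support, d i = k := by
    have := hp (MvPolynomial.mem_support_iff.mp hd)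
    rwa [show Finsupp.weight (1 : σ → ℕ) d = d.degree from
      (DFunLike.congr_fun Finsupp.degree_eq_weight_one d).symm, Finsupp.degree_apply] at this
  rw [← hdeg, ← Finset.prod_pow_eq_pow_sum]
  simp only [mul_pow]
  rw [Finset.prod_mul_distrib]
  ring

lemma GapEquations.smul {lam mu : SY n} {y : Idx n → ℂ} (hz : GapEquations lam mu y) (c : ℂ) :
    GapEquations lam mu fun i => c * y i := by
  refine ⟨fun j hj => ?_, fun hc => ?_, fun g hg => ?_⟩
  · rw [hz.bar_eq_zero j hj, mul_zero]
  · rw [hz.zero_eq_zero hc, mul_zero]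
  · have hscale : c * c * pairSum y g = 0 := by rw [hz.pairSum_eq_zero g hg, mul_zero]
    refine Eq.trans ?_ hscale
    rw [pairSum, pairSum, Finset.mul_sum]
    refine Finset.sum_congr rfl fun i _ => ?_
    split_ifs <;> ring

section
variable {V : Type*} [AddCommGroup V] [Module ℂ V]

lemma repr_smul_eq (e : Basis (Idx n) ℂ V) (c : ℂ) (x : V) :
    (fun i => e.repr (c • x) i) = fun i => c * e.repr x i := by
  funext i
  rw [map_smul, Finsupp.smul_apply, smul_eq_mul]

lemma eval_rep_ne_zero (e : Basis (Idx n) ℂ V) {p : MvPolynomial (Idx n) ℂ} {k : ℕ}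
    (hp : p.IsHomogeneous k) {l : Projectivization ℂ V} {x : V} (hx : x ∈ l.submodule)
    (hpx : MvPolynomial.eval (fun i => e.repr x i) p ≠ 0) :
    MvPolynomial.eval (fun i => e.repr l.rep i) p ≠ 0 := by
  rw [l.submodule_eq] at hx
  obtain ⟨c, rfl⟩ := Submodule.mem_span_singleton.mp hx
  rw [repr_smul_eq, eval_smul_of_isHomogeneous hp] at hpx
  exact right_ne_zero_of_mul hpx

lemma rep_mem_submodule (l : Projectivization ℂ V) : l.rep ∈ l.submodule := by
  rw [l.submodule_eq]
  exact Submodule.mem_span_singleton_self _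

end

end IsotropicPieri

theorem theorem4 {V : Type*} [AddCommGroup V] [Module ℂ V] (n : ℕ)
    (β : LinearMap.BilinForm ℂ V) (e : Module.Basis (IsotropicPieri.Idx n) ℂ V)
    (he : IsotropicPieri.IsStandardBasis β e)
    (lam mu : IsotropicPieri.SY n) (hskew : IsotropicPieri.IsSkewRow lam mu) :
    IsotropicPieri.GeneralLine e
      (IsotropicPieri.linesIn (IsotropicPieri.zeroLocus β e lam mu))
      (fun l => ∃ H : Submodule ℂ V,
        IsotropicPieri.schubert β e mu ∩ IsotropicPieri.schubertOpp β e lam ∩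
          IsotropicPieri.specialSchubert n β l.submodule = {H}) := by
  open IsotropicPieri in
  obtain ⟨k, hk⟩ := exists_isHomogeneous_genericPoly lam mu
  refine ⟨{l | ∀ p ∈ ({genericPoly lam mu} : Set _), ∀ x ∈ l.submodule,
    MvPolynomial.eval (fun i => e.repr x i) p = 0}, ⟨_, ?_, rfl⟩, ?_, ?_⟩
  · rintro p rfl
    exact ⟨k, hk⟩
  · rintro T' ⟨S, hS, rfl⟩ hsub l hl p hp x hx
    by_contra hne
    obtain ⟨m, hm⟩ := hS p hp
    have hrep := eval_rep_ne_zero e hm hx hne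
    have hrep0 : e.repr l.rep ≠ 0 := fun h0 =>
      l.rep_nonzero (e.repr.map_eq_zero_iff.mp h0)
    obtain ⟨a, ha⟩ := Finsupp.ne_iff.mp hrep0
    have hz : GapEquations lam mu (e.repr l.rep) :=
      (mem_zeroLocus_iff he hskew _).mp (hl _ (rep_mem_submodule l))
    -- Density is known for vectors, while the hypothesis on `T'` concerns lines. The factor `X a`,
    -- nonzero at the chosen point, makes the test polynomial vanish at the zero vector, which spans
    -- no line.
    have key := denseNonvanishing_genericPoly hskew (p * MvPolynomial.X a) ?_ _ hz
    · rw [map_mul, MvPolynomial.eval_X] at key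
      exact mul_ne_zero hrep ha key
    intro y hy hgen
    rw [map_mul, MvPolynomial.eval_X]
    by_cases hya : y a = 0
    · rw [hya, mul_zero]
    have hcoord : (fun i => e.repr (e.equivFun.symm y) i) = y := by
      have := e.equivFun.apply_symm_apply y
      rwa [Module.Basis.equivFun_apply] at this
    have hy0 : e.equivFun.symm y ≠ 0 := fun h0 => hya (by rw [← hcoord, h0]; simp)
    have hmem : e.equivFun.symm y ∈ (Projectivization.mk ℂ _ hy0).submodule := by
      rw [Projectivization.submodule_mk]
      exact Submodule.mem_span_singleton_self _
    have hline := hsub (a := Projectivization.mk ℂ _ hy0) ⟨?_, fun hT => hgen ?_⟩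
    · have := hline p hp _ hmem
      rw [hcoord] at this
      rw [this, zero_mul]
    · intro x hx
      rw [Projectivization.submodule_mk] at hx
      obtain ⟨c, rfl⟩ := Submodule.mem_span_singleton.mp hx
      rw [mem_zeroLocus_iff he hskew]
      have h1 := repr_smul_eq e c (e.equivFun.symm y)
      have h2 : ∀ i, e.repr (e.equivFun.symm y) i = y i := congrFun hcoord
      simp only [h2] at h1
      rw [show (e.repr (c • e.equivFun.symm y) : Idx n → ℂ) = _ from h1]
      exact hy.smul c
    · have := hT _ rfl _ hmem
      rwa [hcoord] at this
  · rintro l ⟨hl, hlT⟩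
    have hex : ∃ x ∈ l.submodule,
        MvPolynomial.eval (fun i => e.repr x i) (genericPoly lam mu) ≠ 0 := by
      by_contra hcon
      push Not at hcon
      exact hlT (by rintro p rfl; exact hcon)
    obtain ⟨x, hx, hgx⟩ := hex
    have hgen := isGeneric_of_eval_ne_zero (eval_rep_ne_zero e hk hx hgx)
    have hz : GapEquations lam mu (e.repr l.rep) :=
      (mem_zeroLocus_iff he hskew _).mp (hl _ (rep_mem_submodule l))
    rw [l.submodule_eq]
    exact ⟨_, inter_eq_singleton he hskew l.rep_nonzero hgen hz⟩
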